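/- Let $M$ be a smooth $(2n+1)$-dimensional manifold with a nondegenerate partially integrable CR structure $T^{1,0}M$, i.e. a complex rank-$n$ subbundle of $\mathbb{C}TM$ with $T^{1,0}M\cap\overline{T^{1,0}M}=0$, with $[\Gamma(T^{1,0}M),\Gamma(T^{1,0}M)]\subset\Gamma(T^{1,0}M\oplus\overline{T^{1,0}M})$, and with nondegenerate Levi form (of any signature). Let $\theta$ be a contact form, i.e. a real 1-form on $M$ with kernel $H=\operatorname{Re}T^{1,0}M$, let $T$ be its Reeb vector field ($\theta(T)=1$, $d\theta(T,\cdot)=0$), and let $h(Z,\overline W)=-i\,d\theta(Z,\overline W)$, $Z,W\in T^{1,0}M$, be its Levi form. Let $X=M\times[0,\infty)$ with second coordinate $\rho$, and let ${}^\Theta TX$ be the $\Theta$-tangent bundle of $X$: it is the tangent bundle over $\{\rho>0\}$, and near the boundary it has the local frames $\rho N,\rho^2T',\rho Y_1,\dots,\rho Y_{2n}$, where $N,T',Y_1,\dots,Y_{2n}$ is a smooth local frame of $TX$ such that, on $\partial X=M\times\{0\}$, the $M$-component of $N$ lies in $H$, the vector fields $T',Y_1,\dots,Y_{2n}$ are tangent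 to $\partial X$, and $Y_1,\dots,Y_{2n}$ span $H$. For a local frame $Z_1,\dots,Z_n$ of $T^{1,0}M$ over an open set $V\subset M$ put $$\boldsymbol Z_\infty=\rho\partial_\rho,\quad \boldsymbol Z_0=\rho^2T,\quad \boldsymbol Z_\alpha=\rho Z_\alpha,\quad \boldsymbol Z_{\bar\alpha}=\rho\overline{Z_\alpha},\quad \boldsymbol Z_\tau=\tfrac12\boldsymbol Z_\infty+i\boldsymbol Z_0,\quad \boldsymbol Z_{\bar\tau}=\overline{\boldsymbol Z_\tau}.$$ Let $g$ be a $C^\infty$-smooth ACH metric, normalized with respect to $\theta$, on an open neighborhood $U$ of $M=\partial X$ in $X$. That is, $g$ is a nondegenerate symmetric bilinear form (of any signature) on the fibers of ${}^\Theta TX|_U$, smooth up to the boundary, such that for all frames $\{Z_\alpha\}$ as above $$g_{\infty\infty}=4,\quad g_{\infty0}=0,\quad g_{\infty\alpha}=0\quad\text{in }U,$$ $$g_{00}=1,\quad g_{0\alpha}=0,\quad g_{\alpha\bar\beta}=h_{\alpha\bar\beta},\quad g_{\alpha\beta}=0\quad\text{on }M.$$ Let $R(X_1,X_2,X_3,X_4)=g\big((\nabla_{X_1}\nabla_{X_2}-\nabla_{X_2}\nabla_{X_1}-\nabla_{[X_1,X_2]})X_3,X_4\big)$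 be the Riemann curvature tensor of the Levi-Civita connection $\nabla$ of $g$ in the interior, extended complex-multilinearly. Let $P,Q,P',Q'$ run through $\{\tau,1,\dots,n,\bar\tau,\bar1,\dots,\bar n\}$ and $A,B,C,D$ through $\{\tau,1,\dots,n\}$. Then, for every local frame $\{Z_\alpha\}$ of $T^{1,0}M$ over an open set $V\subset M$, the components $g_{PQ}$ and $R_{PQP'Q'}$ with respect to $\{\boldsymbol Z_P\}=\{\boldsymbol Z_\tau,\boldsymbol Z_\alpha,\boldsymbol Z_{\bar\tau},\boldsymbol Z_{\bar\alpha}\}$ extend smoothly up to the boundary, i.e. to $U\cap(V\times[0,\infty))$, and: 1. All components of $R$ that are not of Kähler type vanish on the boundary: $R_{PQP'Q'}|_M=0$ whenever $P,Q$ are both unbarred or both barred, or $P',Q'$ are both unbarred or both barred. Thus only $R_{A\bar BC\bar D}$, $R_{\bar BAC\bar D}$, $R_{A\bar B\bar DC}$ and $R_{\bar BA\bar DC}$ can be nonzero on $M$. 2. The boundary values of the components of Kähler type are given by $$R_{A\bar BC\bar D}|_M=-\tfrac12\left(g_{A\bar B}\,g_{C\bar D}+g_{A\bar D}\,g_{C\bar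 B}\right)|_M ,$$ that is, the curvature is asymptotically that of complex hyperbolic space. -/

import Mathlib

open scoped Manifold ContDiff Topology TensorProduct

noncomputable section

namespace ACH

/-! ### Generalities: vector fields, complex vector fields, pseudo-Riemannian geometry -/

section General

variable {E : Type*} [NormedAddCommGroup E] [NormedSpace ℝ E]
  {H : Type*} [TopologicalSpace H] (J : ModelWithCorners ℝ E H)
  {N : Type*} [TopologicalSpace N] [ChartedSpace H N]

/-- (Not necessarily continuous) real vector fields on `N`. -/
abbrev VField (N : Type*) [TopologicalSpace N] [ChartedSpace H N] : Type _ :=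
  ∀ x : N, TangentSpace J x

/-- The vector field `X` is `C^∞` on the set `S` (up to the boundary points contained in `S`). -/
def SmoothFieldOn [IsManifold J ∞ N] (X : VField J N) (S : Set N) : Prop :=
  ContMDiffOn J J.tangent ∞ (fun x => (⟨x, X x⟩ : TangentBundle J N)) S

/-- The vector field `X` is `C^∞` near the point `x`. -/
def SmoothFieldAt [IsManifold J ∞ N] (X : VField J N) (x : N) : Prop :=
  ContMDiffAt J J.tangent ∞ (fun y => (⟨y, X y⟩ : TangentBundle J N)) x

/-- Derivative `X f` of a function along a vector field. -/
def deriv (X : VField J N) (f : N → ℝ) (x : N) : ℝ :=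
  mfderiv J 𝓘(ℝ, ℝ) f x (X x)

/-- Lie bracket of vector fields. -/
def bracket (X Y : VField J N) : VField J N :=
  VectorField.mlieBracket J X Y

/-- A complex vector field (section of `ℂ ⊗ TN`), given by its real and imaginary part. -/
structure CField (N : Type*) [TopologicalSpace N] [ChartedSpace H N] where
  re : VField J N
  im : VField J N

variable {J}

namespace CField

/-- The value of a complex vector field, in the complexified tangent space. -/
def val (Z : CField J N) (x : N) : ℂ ⊗[ℝ] TangentSpace J x :=
  (1 : ℂ) ⊗ₜ[ℝ] Z.re x + Complex.I ⊗ₜ[ℝ] Z.im x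

/-- Complex conjugate. -/
def conj (Z : CField J N) : CField J N := ⟨Z.re, fun x => -Z.im x⟩

/-- A complex vector field is `C^∞` if its real and imaginary part are. -/
def SmoothOn [IsManifold J ∞ N] (Z : CField J N) (S : Set N) : Prop :=
  SmoothFieldOn J Z.re S ∧ SmoothFieldOn J Z.im S

/-- The `ℂ`-bilinear extension of the Lie bracket. -/
def lie (Z W : CField J N) : CField J N where
  re := fun x => bracket J Z.re W.re x - bracket J Z.im W.im x
  im := fun x => bracket J Z.re W.im x + bracket J Z.im W.re x

/-- Real part (`false`) or imaginary part (`true`). -/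
def part (Z : CField J N) (b : Bool) : VField J N := if b then Z.im else Z.re

end CField

/-- `1` for the real part, `i` for the imaginary part. -/
def unitOf (b : Bool) : ℂ := if b then Complex.I else 1

/-- `ℂ`-bilinear extension of an operation on two real vector fields. -/
def cExt₂ (B : VField J N → VField J N → N → ℝ) (Z W : CField J N) (x : N) : ℂ :=
  ∑ a : Bool, ∑ b : Bool, unitOf a * unitOf b * (B (Z.part a) (W.part b) x : ℂ)

/-- `ℂ`-multilinear extension of an operation on four real vector fields. -/
def cExt₄ (B : VField J N → VField J N → VField J N → VField J N → N → ℝ)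
    (Z₁ Z₂ Z₃ Z₄ : CField J N) (x : N) : ℂ :=
  ∑ a : Bool, ∑ b : Bool, ∑ c : Bool, ∑ d : Bool, unitOf a * unitOf b * unitOf c * unitOf d *
    (B (Z₁.part a) (Z₂.part b) (Z₃.part c) (Z₄.part d) x : ℂ)

/-- Exterior derivative of a `1`-form:
`dθ(X,Y) = X(θ(Y)) - Y(θ(X)) - θ([X,Y])`. -/
def extDeriv (θ : ∀ x : N, TangentSpace J x →ₗ[ℝ] ℝ) (X Y : VField J N) (x : N) : ℝ :=
  deriv J X (fun y => θ y (Y y)) x - deriv J Y (fun y => θ y (X y)) x - θ x (bracket J X Y x)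

variable (g : ∀ x : N, LinearMap.BilinForm ℝ (TangentSpace J x))

/-- The function `g(X,Y)`. -/
def inner (X Y : VField J N) (x : N) : ℝ := g x (X x) (Y x)

/-- The Koszul expression, which equals `2 g(∇_X Y, W)` for the Levi-Civita connection `∇`. -/
def koszul (X Y W : VField J N) (x : N) : ℝ :=
  deriv J X (inner g Y W) x + deriv J Y (inner g X W) x - deriv J W (inner g X Y) x
    + inner g (bracket J X Y) W x - inner g (bracket J X W) Y x - inner g (bracket J Y W) X x

open Classical in
/-- The Levi-Civita connection `∇_X Y` of a pseudo-Riemannian metric: `(∇_X Y)(x)` is the tangent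
vector `v` with `2 g(v, W) = koszul g X Y W` at `x` for all vector fields `W` that are smooth near
`x`. Where `g`, `X`, `Y` are smooth and `g` is nondegenerate there is exactly one such `v`. -/
def leviCivita [IsManifold J ∞ N] (X Y : VField J N) : VField J N := fun x =>
  if h : ∃ v : TangentSpace J x, ∀ W : VField J N, SmoothFieldAt J W x →
      2 * g x v (W x) = koszul g X Y W x
  then h.choose else 0

/-- Riemann curvature tensor
`R(X,Y,Z,W) = g(∇_X ∇_Y Z - ∇_Y ∇_X Z - ∇_[X,Y] Z, W)`. -/
def riemann [IsManifold J ∞ N] (X Y Z W : VField J N) (x : N) : ℝ :=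
  g x (leviCivita g X (leviCivita g Y Z) x - leviCivita g Y (leviCivita g X Z) x
    - leviCivita g (bracket J X Y) Z x) (W x)

end General

/-! ### Partially integrable CR manifolds -/

/-- The model space of `(2n+1)`-dimensional manifolds. -/
abbrev Model (n : ℕ) : Type := EuclideanSpace ℝ (Fin (2 * n + 1))

section CR

variable {n : ℕ} {M : Type*} [TopologicalSpace M] [ChartedSpace (Model n) M]
  [IsManifold (𝓡 (2 * n + 1)) ∞ M]

/-- Complex conjugation on a complexified real vector space. -/
def conjC (V : Type*) [AddCommGroup V] [Module ℝ V] : ℂ ⊗[ℝ] V →ₗ[ℝ] ℂ ⊗[ℝ] V :=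
  LinearMap.rTensor V Complex.conjAe.toLinearMap

/-- The real part map on a complexified real vector space. -/
def reC (V : Type*) [AddCommGroup V] [Module ℝ V] : ℂ ⊗[ℝ] V →ₗ[ℝ] V :=
  (TensorProduct.lid ℝ V).toLinearMap ∘ₗ LinearMap.rTensor V Complex.reLm

/-- `Z₁, …, Zₙ` is a smooth local frame over `V` of the family `T10` of complex subspaces. -/
structure IsFrameOf
    (T10 : ∀ p : M, Submodule ℂ (ℂ ⊗[ℝ] TangentSpace (𝓡 (2 * n + 1)) p))
    (V : Set M) (Z : Fin n → CField (𝓡 (2 * n + 1)) M) : Prop where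
  smooth : ∀ α, (Z α).SmoothOn V
  linearIndependent : ∀ p ∈ V, LinearIndependent ℂ (fun α => (Z α).val p)
  span_eq : ∀ p ∈ V, Submodule.span ℂ (Set.range fun α => (Z α).val p) = T10 p

variable (n M) in
/-- A partially integrable (almost) CR structure of hypersurface type on a `(2n+1)`-dimensional
manifold: a smooth complex subbundle `T^{1,0}` of rank `n` of the complexified tangent bundle with
`T^{1,0} ∩ conj T^{1,0} = 0` such that brackets of sections of `T^{1,0}` are sections of
`T^{1,0} ⊕ conj T^{1,0}`. -/
structure PartiallyIntegrableCR where
  T10 : ∀ p : M, Submodule ℂ (ℂ ⊗[ℝ] TangentSpace (𝓡 (2 * n + 1)) p)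
  exists_frame : ∀ p : M, ∃ V : Set M, IsOpen V ∧ p ∈ V ∧
    ∃ Z : Fin n → CField (𝓡 (2 * n + 1)) M, IsFrameOf T10 V Z
  conj_inter : ∀ (p : M), ∀ v ∈ T10 p, conjC _ v ∈ T10 p → v = 0
  bracket_mem : ∀ (V : Set M) (Z W : CField (𝓡 (2 * n + 1)) M), IsOpen V →
    Z.SmoothOn V → W.SmoothOn V → (∀ p ∈ V, Z.val p ∈ T10 p) → (∀ p ∈ V, W.val p ∈ T10 p) →
    ∀ p ∈ V, (Z.lie W).val p ∈
      Submodule.span ℂ ((T10 p : Set (ℂ ⊗[ℝ] TangentSpace (𝓡 (2 * n + 1)) p)) ∪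
        {v | conjC _ v ∈ T10 p})

/-- The hyperplane distribution `H = Re T^{1,0}`. -/
def PartiallyIntegrableCR.distribution (S : PartiallyIntegrableCR n M) (p : M) :
    Submodule ℝ (TangentSpace (𝓡 (2 * n + 1)) p) :=
  ((S.T10 p).restrictScalars ℝ).map (reC _)

/-- The components `h_{αβ̄} = h(Z_α, conj Z_β) = -i dθ(Z_α, conj Z_β)` of the Levi form. -/
def leviForm (θ : ∀ p : M, TangentSpace (𝓡 (2 * n + 1)) p →ₗ[ℝ] ℝ)
    (Z : Fin n → CField (𝓡 (2 * n + 1)) M) (α β : Fin n) (p : M) : ℂ :=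
  -Complex.I * cExt₂ (extDeriv θ) (Z α) (Z β).conj p

/-- `θ` is a contact form (pseudohermitian structure) for the CR structure `S`, which is
nondegenerate: `θ` is a smooth `1`-form with kernel `H` and its Levi form is nondegenerate
(of any signature). -/
structure IsContactForm (S : PartiallyIntegrableCR n M)
    (θ : ∀ p : M, TangentSpace (𝓡 (2 * n + 1)) p →ₗ[ℝ] ℝ) : Prop where
  smooth : ∀ (V : Set M) (X : VField (𝓡 (2 * n + 1)) M), IsOpen V →
    SmoothFieldOn _ X V → ContMDiffOn (𝓡 (2 * n + 1)) 𝓘(ℝ, ℝ) ∞ (fun p => θ p (X p)) V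
  ker_eq : ∀ p, LinearMap.ker (θ p) = S.distribution p
  nondegenerate : ∀ (V : Set M) (Z : Fin n → CField (𝓡 (2 * n + 1)) M), IsOpen V →
    IsFrameOf S.T10 V Z → ∀ p ∈ V, (Matrix.of fun α β => leviForm θ Z α β p).det ≠ 0

/-- `T` is the Reeb vector field of `θ`: `θ(T) = 1` and `dθ(T, ·) = 0`. -/
structure IsReebField (θ : ∀ p : M, TangentSpace (𝓡 (2 * n + 1)) p →ₗ[ℝ] ℝ)
    (T : VField (𝓡 (2 * n + 1)) M) : Prop where
  smooth : SmoothFieldOn _ T Set.univ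
  apply_eq_one : ∀ p, θ p (T p) = 1
  contract_eq_zero : ∀ (V : Set M) (X : VField (𝓡 (2 * n + 1)) M), IsOpen V →
    SmoothFieldOn _ X V → ∀ p ∈ V, extDeriv θ T X p = 0

/-! ### The product `Θ`-manifold `X = M × [0, ∞)`

`X` is realized as the closed subset `{(p, ρ) | 0 ≤ ρ}` of `M × ℝ`; functions and vector fields are
`C^∞` up to the boundary if they are `C^∞` on (relatively open subsets of) this set. The tangent
space of `M × ℝ` at `(p, ρ)` is `T_p M × ℝ`. -/

/-- The model with corners of `M × ℝ`. -/
abbrev prodModel (n : ℕ) : ModelWithCorners ℝ (Model n × ℝ) (ModelProd (Model n) ℝ) :=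
  (𝓡 (2 * n + 1)).prod 𝓘(ℝ, ℝ)

/-- The part in `M × [0, ∞)` of a set. -/
def half (O : Set (M × ℝ)) : Set (M × ℝ) := {x | x ∈ O ∧ 0 ≤ x.2}

/-- A tangent vector of `M × ℝ` with given components. -/
def mkVec (x : M × ℝ) (u : TangentSpace (𝓡 (2 * n + 1)) x.1) (s : ℝ) :
    TangentSpace (prodModel n) x := ((u, s) : Model n × ℝ)

/-- The component in `TM` of a tangent vector of `M × ℝ`. -/
def horPart {x : M × ℝ} (v : TangentSpace (prodModel n) x) : TangentSpace (𝓡 (2 * n + 1)) x.1 :=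
  (show Model n × ℝ from v).1

/-- The component `dρ(v)` of a tangent vector of `M × ℝ`. -/
def rhoPart {x : M × ℝ} (v : TangentSpace (prodModel n) x) : ℝ :=
  (show Model n × ℝ from v).2

/-- Vector fields `N, T', Y₁, …, Y₂ₙ` on the open subset `O ∩ X` of `X` that form a frame of `TX`
adapted to the standard `Θ`-structure `[Θ]` (which annihilates `∂_ρ` and pulls back to `[θ]` on the
boundary): `Θ(N) = 0` on the boundary, `T', Yᵢ` are tangent to the boundary, and on the boundary the
`Yᵢ` span `ker θ`. -/
structure IsAdaptedFrame (θ : ∀ p : M, TangentSpace (𝓡 (2 * n + 1)) p →ₗ[ℝ] ℝ)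
    (O : Set (M × ℝ)) (N T' : VField (prodModel n) (M × ℝ))
    (Y : Fin (2 * n) → VField (prodModel n) (M × ℝ)) : Prop where
  smooth_N : SmoothFieldOn _ N (half O)
  smooth_T : SmoothFieldOn _ T' (half O)
  smooth_Y : ∀ i, SmoothFieldOn _ (Y i) (half O)
  linearIndependent : ∀ x ∈ half O, LinearIndependent ℝ
    (Sum.elim (fun _ : Unit => N x) (Sum.elim (fun _ : Unit => T' x) (fun i => Y i x)))
  theta_N : ∀ x ∈ O, x.2 = 0 → θ x.1 (horPart (N x)) = 0
  tangent_T : ∀ x ∈ O, x.2 = 0 → rhoPart (T' x) = 0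
  tangent_Y : ∀ x ∈ O, x.2 = 0 → ∀ i, rhoPart (Y i x) = 0
  theta_Y : ∀ x ∈ O, x.2 = 0 → ∀ i, θ x.1 (horPart (Y i x)) = 0

/-- The frame `ρN, ρ²T', ρY₁, …, ρY₂ₙ` of the `Θ`-tangent bundle given by an adapted frame. -/
def thetaFrame (N T' : VField (prodModel n) (M × ℝ))
    (Y : Fin (2 * n) → VField (prodModel n) (M × ℝ)) :
    Unit ⊕ Unit ⊕ Fin (2 * n) → VField (prodModel n) (M × ℝ) :=
  Sum.elim (fun _ x => x.2 • N x)
    (Sum.elim (fun _ x => x.2 ^ 2 • T' x) (fun i x => x.2 • Y i x))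

/-- `F` is `C^∞` on `O ∩ X`, up to the boundary, and agrees with `f` in the interior `ρ > 0`. -/
def IsSmoothExtension {F' : Type*} [NormedAddCommGroup F'] [NormedSpace ℝ F']
    (O : Set (M × ℝ)) (f F : M × ℝ → F') : Prop :=
  ContMDiffOn (prodModel n) 𝓘(ℝ, F') ∞ F (half O) ∧ ∀ x ∈ O, 0 < x.2 → F x = f x

/-- `g` is a `C^∞` `Θ`-metric on `U ∩ X`, i.e. a smooth fiber metric (nondegenerate symmetric
bilinear form, of any signature) of the `Θ`-tangent bundle. It is given by its values in the
interior `ρ > 0`, where the `Θ`-tangent bundle is the tangent bundle; it has to extend to the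
boundary in the frames `ρN, ρ²T', ρYᵢ`, smoothly and nondegenerately. -/
structure IsThetaMetric (θ : ∀ p : M, TangentSpace (𝓡 (2 * n + 1)) p →ₗ[ℝ] ℝ)
    (U : Set (M × ℝ)) (g : ∀ x : M × ℝ, LinearMap.BilinForm ℝ (TangentSpace (prodModel n) x)) :
    Prop where
  symm : ∀ x ∈ U, 0 < x.2 → ∀ v w, g x v w = g x w v
  smooth_nondegenerate : ∀ (O : Set (M × ℝ)) (N T' : VField (prodModel n) (M × ℝ))
    (Y : Fin (2 * n) → VField (prodModel n) (M × ℝ)), IsOpen O → O ⊆ U →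
    IsAdaptedFrame θ O N T' Y →
    ∃ G : Unit ⊕ Unit ⊕ Fin (2 * n) → Unit ⊕ Unit ⊕ Fin (2 * n) → M × ℝ → ℝ,
      (∀ i j, IsSmoothExtension (n := n) O
        (inner g (thetaFrame N T' Y i) (thetaFrame N T' Y j)) (G i j)) ∧
      ∀ x ∈ half O, (Matrix.of fun i j => G i j x).det ≠ 0

/-- `c` is the boundary value at `p` of the function `f` on the interior `ρ > 0`. -/
def HasBoundaryValue (f : M × ℝ → ℂ) (p : M) (c : ℂ) : Prop :=
  Filter.Tendsto f (𝓝[{x : M × ℝ | 0 < x.2}] (p, 0)) (𝓝 c)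

/-! ### The frame `{Z_I}` and normalized ACH metrics -/

/-- `Z_∞ = ρ ∂_ρ`. -/
def zInfty : CField (prodModel n) (M × ℝ) := ⟨fun x => mkVec x 0 x.2, fun _ => 0⟩

/-- `Z_0 = ρ² T`. -/
def zZero (T : VField (𝓡 (2 * n + 1)) M) : CField (prodModel n) (M × ℝ) :=
  ⟨fun x => mkVec x (x.2 ^ 2 • T x.1) 0, fun _ => 0⟩

/-- `Z_α = ρ Z_α` for a section `Z_α` of the complexified tangent bundle of `M`. -/
def zHor (Z : CField (𝓡 (2 * n + 1)) M) : CField (prodModel n) (M × ℝ) :=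
  ⟨fun x => mkVec x (x.2 • Z.re x.1) 0, fun x => mkVec x (x.2 • Z.im x.1) 0⟩

/-- `Z_τ = ½ Z_∞ + i Z_0`. -/
def zTau (T : VField (𝓡 (2 * n + 1)) M) : CField (prodModel n) (M × ℝ) :=
  ⟨fun x => (1 / 2 : ℝ) • zInfty.re x, fun x => (zZero T).re x⟩

/-- The frame `{Z_P} = {Z_τ, Z_α, conj Z_τ, conj Z_α}`. An index is a pair `(A, b)`, where `none`
stands for `τ` and `some α` for `α`, and where `b = true` for the barred indices. -/
def zFrame (T : VField (𝓡 (2 * n + 1)) M) (Z : Fin n → CField (𝓡 (2 * n + 1)) M) :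
    Option (Fin n) × Bool → CField (prodModel n) (M × ℝ)
  | (none, false) => zTau T
  | (some α, false) => zHor (Z α)
  | (none, true) => (zTau T).conj
  | (some α, true) => (zHor (Z α)).conj

/-- `g` is a `C^∞` ACH metric on the open neighborhood `U ∩ X` of `M` in `X`, with the prescribed
boundary values with respect to the contact form `θ` with Reeb field `T`. -/
structure IsACHMetric (S : PartiallyIntegrableCR n M)
    (θ : ∀ p : M, TangentSpace (𝓡 (2 * n + 1)) p →ₗ[ℝ] ℝ) (T : VField (𝓡 (2 * n + 1)) M)
    (U : Set (M × ℝ)) (g : ∀ x : M × ℝ, LinearMap.BilinForm ℝ (TangentSpace (prodModel n) x)) :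
    Prop where
  isOpen : IsOpen U
  boundary_mem : ∀ p : M, (p, (0 : ℝ)) ∈ U
  thetaMetric : IsThetaMetric θ U g
  infty_infty : ∀ p, HasBoundaryValue (cExt₂ (inner g) zInfty zInfty) p 4
  infty_zero : ∀ p, HasBoundaryValue (cExt₂ (inner g) zInfty (zZero T)) p 0
  zero_zero : ∀ p, HasBoundaryValue (cExt₂ (inner g) (zZero T) (zZero T)) p 1
  infty_hor : ∀ (V : Set M) (Z : Fin n → CField (𝓡 (2 * n + 1)) M), IsOpen V →
    IsFrameOf S.T10 V Z → ∀ p ∈ V, ∀ α,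
      HasBoundaryValue (cExt₂ (inner g) zInfty (zHor (Z α))) p 0
  zero_hor : ∀ (V : Set M) (Z : Fin n → CField (𝓡 (2 * n + 1)) M), IsOpen V →
    IsFrameOf S.T10 V Z → ∀ p ∈ V, ∀ α,
      HasBoundaryValue (cExt₂ (inner g) (zZero T) (zHor (Z α))) p 0
  hor_conj : ∀ (V : Set M) (Z : Fin n → CField (𝓡 (2 * n + 1)) M), IsOpen V →
    IsFrameOf S.T10 V Z → ∀ p ∈ V, ∀ α β,
      HasBoundaryValue (cExt₂ (inner g) (zHor (Z α)) (zHor (Z β)).conj) p (leviForm θ Z α β p)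
  hor_hor : ∀ (V : Set M) (Z : Fin n → CField (𝓡 (2 * n + 1)) M), IsOpen V →
    IsFrameOf S.T10 V Z → ∀ p ∈ V, ∀ α β,
      HasBoundaryValue (cExt₂ (inner g) (zHor (Z α)) (zHor (Z β))) p 0

/-- The ACH metric `g` is normalized (with respect to `θ`): `g_{∞∞} = 4`, `g_{∞0} = 0` and
`g_{∞α} = 0` everywhere in `U`. -/
structure IsNormalizedACHMetric (S : PartiallyIntegrableCR n M)
    (θ : ∀ p : M, TangentSpace (𝓡 (2 * n + 1)) p →ₗ[ℝ] ℝ) (T : VField (𝓡 (2 * n + 1)) M)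
    (U : Set (M × ℝ)) (g : ∀ x : M × ℝ, LinearMap.BilinForm ℝ (TangentSpace (prodModel n) x)) :
    Prop extends IsACHMetric S θ T U g where
  infty_infty_eq : ∀ x ∈ U, 0 < x.2 → cExt₂ (inner g) zInfty zInfty x = 4
  infty_zero_eq : ∀ x ∈ U, 0 < x.2 → cExt₂ (inner g) zInfty (zZero T) x = 0
  infty_hor_eq : ∀ (V : Set M) (Z : Fin n → CField (𝓡 (2 * n + 1)) M), IsOpen V →
    IsFrameOf S.T10 V Z → ∀ x ∈ U, x.1 ∈ V → 0 < x.2 → ∀ α,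
      cExt₂ (inner g) zInfty (zHor (Z α)) x = 0

end CR

end ACH

end

/-!
The curvature of `g` is computed in the frame `e = (ρ∂_ρ, ρ²T, ρ Re Z_α, ρ Im Z_α)` of the
`Θ`-tangent bundle, which consists of honest vector fields over `ρ > 0`.

The structure functions `c` of this frame are smooth up to `ρ = 0` (`bracket_prodThetaFrame`,
`contMDiffAt_thetaStructure`), and so is the invertible matrix `G` of the metric
(`IsThetaMetric.exists_gram`). The Christoffel symbols given by the Koszul formula are rational
expressions in `G`, `c` and the derivatives of `G` along `e`; the same formula with derivatives
within `{ρ ≥ 0}` extends them smoothly to the boundary, and with them the components of the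
curvature tensor (`christoffel`, `curvArray`, `riemann_eq_curvArray`, `contMDiffOn_curvArray`).

As the members of `e` vanish at `ρ = 0`, all derivatives along them vanish there. Hence at a
boundary point the Koszul formula and the formula for the curvature become purely algebraic
(`koszul_christoffel`, `curvArray_eq_algCurv`): they are those of a left invariant metric on a Lie
group whose Lie algebra has the structure constants `c(p, 0)`. In the complexified frame `Z_P`, the
brackets are
`[Z_τ, Z_τ̄] = Z_τ̄ - Z_τ`, `[Z_τ, Z_α] = ½ Z_α`, `[Z_τ, Z_ᾱ] = ½ Z_ᾱ`, `[Z_α, Z_β] = 0` and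
`[Z_α, Z_β̄] = ½ h_{αβ̄} (Z_τ̄ - Z_τ)`. The last two come from partial integrability
(`thetaBracket_same`) and from the definition of the Levi form (`thetaBracket_conj`). Together with
the boundary values `g_{ττ̄} = 2`, `g_{αβ̄} = h_{αβ̄}` of the metric, where the components that are
not obtained from these by symmetry or conjugation vanish, this is the solvable model of complex
hyperbolic space (`isHyperbolicModel_boundary`), for a form `h` of any signature. Its Levi-Civita
connection preserves the type of the differentiated field (`IsHyperbolicModel.nab_eq`), and its
curvature is a direct computation (`IsHyperbolicModel.curvature_eq`).
-/

noncomputable section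

namespace ACH

/-! ### Smoothness of inverse matrices and of frame coefficients -/

section Smooth

variable {E : Type*} [NormedAddCommGroup E] [NormedSpace ℝ E]
  {H : Type*} [TopologicalSpace H] {J : ModelWithCorners ℝ E H}
  {N : Type*} [TopologicalSpace N] [ChartedSpace H N]
  {ι : Type*} [Fintype ι] [DecidableEq ι] {k : ℕ∞ω} {s : Set N} {x : N}

lemma contMDiffWithinAt_matrix_det {A : N → Matrix ι ι ℝ}
    (hA : ∀ i j, ContMDiffWithinAt J 𝓘(ℝ, ℝ) k (fun y => A y i j) s x) :
    ContMDiffWithinAt J 𝓘(ℝ, ℝ) k (fun y => (A y).det) s x := by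
  simp only [Matrix.det_apply']
  exact contMDiffWithinAt_finsetSum fun σ _ =>
    contMDiffWithinAt_const.mul (contMDiffWithinAt_finsetProd fun i _ => hA _ _)

lemma contMDiffWithinAt_matrix_inv {A : N → Matrix ι ι ℝ}
    (hA : ∀ i j, ContMDiffWithinAt J 𝓘(ℝ, ℝ) k (fun y => A y i j) s x)
    (hdet : (A x).det ≠ 0) (i j : ι) :
    ContMDiffWithinAt J 𝓘(ℝ, ℝ) k (fun y => (A y)⁻¹ i j) s x := by
  simp only [Matrix.inv_def, Matrix.smul_apply, Ring.inverse_eq_inv', smul_eq_mul,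
    Matrix.adjugate_apply]
  refine ((contMDiffWithinAt_matrix_det hA).inv₀ hdet).mul
    (contMDiffWithinAt_matrix_det fun a b => ?_)
  by_cases h : a = j
  · subst h
    simpa using contMDiffWithinAt_const
  · simpa [Matrix.updateRow_ne h] using hA a b

variable [FiniteDimensional ℝ E] [IsManifold J ∞ N]

/-- The coefficients of a smooth vector field in a smooth local frame are smooth: they are obtained
from the coefficients in the frame of a trivialization by multiplication with an inverse matrix. -/
lemma contMDiffAt_coeff {e : ι → VField J N} {Ω : Set N} (he : IsLocalFrameOn J E ∞ e Ω)
    (hΩ : IsOpen Ω) (hx : x ∈ Ω) {t : VField J N} (ht : SmoothFieldAt J t x) (i : ι) :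
    ContMDiffAt J 𝓘(ℝ, ℝ) ∞ (fun y => he.coeff i y (t y)) x := by
  let b : Module.Basis ι ℝ E := he.toBasisAt hx
  let tr := trivializationAt E (TangentSpace J : N → Type _) x
  have hxt : x ∈ tr.baseSet := FiberBundle.mem_baseSet_trivializationAt' x
  let A : N → Matrix ι ι ℝ := fun y => Matrix.of fun a c => tr.localFrameCoeff J b a y (e c y)
  have hA : ∀ a c, ContMDiffAt J 𝓘(ℝ, ℝ) ∞ (fun y => A y a c) x := fun a c =>
    contMDiffAt_localFrameCoeff b hxt (he.contMDiffAt hΩ hx c) a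
  have hτ : ∀ a, ContMDiffAt J 𝓘(ℝ, ℝ) ∞ (fun y => tr.localFrameCoeff J b a y (t y)) x :=
    fun a => contMDiffAt_localFrameCoeff b hxt ht a
  have hdet : (A x).det ≠ 0 := by
    have : A x = (tr.basisAt b hxt).toMatrix (he.toBasisAt hx) := by
      ext a c
      simp only [A, Matrix.of_apply, Module.Basis.toMatrix_apply]
      rw [tr.localFrameCoeff_apply_of_mem_baseSet b hxt]
      simp
    rw [this]
    intro h0
    have := congrArg Matrix.det
      ((tr.basisAt b hxt).toMatrix_mul_toMatrix_flip (he.toBasisAt hx))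
    rw [Matrix.det_mul, h0] at this
    simp at this
  have hev : ∀ᶠ y in 𝓝 x, (A y).det ≠ 0 :=
    (ContMDiffWithinAt.continuousWithinAt (s := Set.univ)
      (contMDiffWithinAt_matrix_det (J := J) (k := ∞) fun a c => (hA a c))
      |>.continuousAt Filter.univ_mem).eventually_ne hdet
  have key : (fun y => he.coeff i y (t y)) =ᶠ[𝓝 x]
      fun y => ∑ a, (A y)⁻¹ i a * tr.localFrameCoeff J b a y (t y) := by
    filter_upwards [hev, hΩ.mem_nhds hx] with y hy hyΩ
    have h1 : (A y).mulVec (fun c => he.coeff c y (t y))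
        = fun a => tr.localFrameCoeff J b a y (t y) := by
      funext a
      conv_rhs => rw [he.coeff_sum_eq t hyΩ]
      simp only [map_sum, map_smul, Matrix.mulVec, dotProduct, A, Matrix.of_apply, smul_eq_mul]
      exact Finset.sum_congr rfl fun c _ => mul_comm _ _
    have h2 := congrArg (fun v => (A y)⁻¹.mulVec v i) h1
    simp only [Matrix.mulVec_mulVec, Matrix.nonsing_inv_mul _ (isUnit_iff_ne_zero.2 hy),
      Matrix.one_mulVec] at h2
    exact h2
  refine ContMDiffAt.congr_of_eventuallyEq ?_ key
  exact contMDiffWithinAt_finsetSum fun a _ =>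
    (contMDiffWithinAt_matrix_inv (J := J) (s := Set.univ) (fun a c => hA a c) hdet i a).mul (hτ a)

end Smooth

/-! ### Contraction of coefficient arrays -/

section Arrays

variable {ι R : Type*} [Fintype ι] [CommRing R]

/-- The bilinear form with matrix `G`. -/
def bil (G : ι → ι → R) : (ι → R) →ₗ[R] (ι → R) →ₗ[R] R :=
  LinearMap.mk₂ R (fun u v => ∑ I, ∑ J, u I * v J * G I J)
    (fun u u' v => by simp only [Pi.add_apply, add_mul, Finset.sum_add_distrib])
    (fun a u v => by simp only [Pi.smul_apply, smul_eq_mul, mul_assoc, Finset.mul_sum])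
    (fun u v v' => by simp only [Pi.add_apply, mul_add, add_mul, Finset.sum_add_distrib])
    (fun a u v => by
      simp only [Pi.smul_apply, smul_eq_mul, Finset.mul_sum]
      exact Finset.sum_congr rfl fun _ _ => Finset.sum_congr rfl fun _ _ => by ring)

lemma bil_apply (G : ι → ι → R) (u v : ι → R) :
    bil G u v = ∑ I, ∑ J, u I * v J * G I J := rfl

/-- The bilinear product with structure constants `A`. -/
def tri (A : ι → ι → ι → R) : (ι → R) →ₗ[R] (ι → R) →ₗ[R] (ι → R) :=
  LinearMap.mk₂ R (fun u v K => bil (fun I J => A I J K) u v)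
    (fun u u' v => by ext; simp) (fun a u v => by ext; simp)
    (fun u v v' => by ext; simp) (fun a u v => by ext; simp)

lemma tri_apply (A : ι → ι → ι → R) (u v : ι → R) (K : ι) :
    tri A u v K = ∑ I, ∑ J, u I * v J * A I J K := rfl

lemma bil_single [DecidableEq ι] (G : ι → ι → R) (I J : ι) :
    bil G (Pi.single I 1) (Pi.single J 1) = G I J := by
  rw [bil_apply, Finset.sum_eq_single I, Finset.sum_eq_single J]
  · simp
  · intro b _ hb; simp [hb]
  · simp
  · intro b _ hb; simp [hb]
  · simp

lemma tri_single [DecidableEq ι] (A : ι → ι → ι → R) (I J : ι) :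
    tri A (Pi.single I 1) (Pi.single J 1) = A I J := by
  ext K
  exact bil_single _ I J

lemma bil_single_right [DecidableEq ι] (G : ι → ι → R) (u : ι → R) (L : ι) :
    bil G u (Pi.single L 1) = ∑ M, u M * G M L := by
  rw [bil_apply]
  refine Finset.sum_congr rfl fun M _ => ?_
  rw [Finset.sum_eq_single L]
  · simp
  · intro b _ hb; simp [hb]
  · simp

/-- Linear maps that agree on the standard basis are equal; unbundled, so that an expression can be
checked on the basis in one argument after the other. -/
lemma eq_of_isLinearMap [DecidableEq ι] {f f' : (ι → R) → R} (hf : IsLinearMap R f)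
    (hf' : IsLinearMap R f') (h : ∀ I, f (Pi.single I 1) = f' (Pi.single I 1)) (u : ι → R) :
    f u = f' u := by
  have := LinearMap.pi_ext' (f := hf.mk' f) (g := hf'.mk' f') fun I => LinearMap.ext_ring (h I)
  exact congrArg (fun l : (ι → R) →ₗ[R] R => l u) this

lemma bil_symm {G : ι → ι → R} (hG : ∀ I J, G I J = G J I) (u v : ι → R) :
    bil G u v = bil G v u := by
  rw [bil_apply, bil_apply, Finset.sum_comm]
  exact Finset.sum_congr rfl fun I _ => Finset.sum_congr rfl fun J _ => by rw [hG]; ring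

/-- A form with invertible matrix is nondegenerate. -/
lemma eq_zero_of_bil_eq_zero [DecidableEq ι] [IsDomain R] {G : ι → ι → R}
    (hG : (Matrix.of G).det ≠ 0) {u : ι → R} (h : ∀ J, bil G u (Pi.single J 1) = 0) : u = 0 := by
  refine Matrix.eq_zero_of_vecMul_eq_zero hG (funext fun J => ?_)
  rw [Pi.zero_apply, ← h J, bil_single_right]
  rfl

lemma bil_ofReal {ι : Type*} [Fintype ι] (G : ι → ι → ℝ) (u v : ι → ℝ) :
    bil (fun I J => (G I J : ℂ)) (fun I => (u I : ℂ)) (fun I => (v I : ℂ)) = bil G u v := by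
  simp only [bil_apply]; push_cast; rfl

lemma tri_ofReal {ι : Type*} [Fintype ι] (A : ι → ι → ι → ℝ) (u v : ι → ℝ) :
    tri (fun I J K => (A I J K : ℂ)) (fun I => (u I : ℂ)) (fun I => (v I : ℂ)) =
      fun K => (tri A u v K : ℂ) := by
  ext K; simp only [tri_apply]; push_cast; rfl

end Arrays

/-! ### The Levi-Civita connection in a frame -/

section Frame

variable {E : Type*} [NormedAddCommGroup E] [NormedSpace ℝ E]
  {H : Type*} [TopologicalSpace H] {J : ModelWithCorners ℝ E H}
  {N : Type*} [TopologicalSpace N] [ChartedSpace H N]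
  {ι : Type*} [Fintype ι]

/-- The vector field with coefficients `a` in the frame `e`. -/
def combo (e : ι → VField J N) (a : N → ι → ℝ) : VField J N := fun x => ∑ I, a x I • e I x

/-- The derivatives along `X` of the coefficients `a`. -/
def dvec (X : VField J N) (a : N → ι → ℝ) (x : N) : ι → ℝ := fun I => deriv J X (fun y => a y I) x

/-- The matrix of the metric in the frame `e`. -/
def gram (g : ∀ x : N, LinearMap.BilinForm ℝ (TangentSpace J x)) (e : ι → VField J N) (x : N) :
    ι → ι → ℝ := fun I K => inner g (e I) (e K) x

lemma deriv_congr {X Y : VField J N} {f h : N → ℝ} {x : N} (hX : X x = Y x) (hf : f =ᶠ[𝓝 x] h) :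
    deriv J X f x = deriv J Y h x := by
  unfold deriv
  rw [hf.mfderiv_eq, hX]
  rfl

lemma deriv_const (X : VField J N) (c : ℝ) (x : N) : deriv J X (fun _ => c) x = 0 := by
  unfold deriv
  rw [mfderiv_const]; rfl

lemma deriv_add {X : VField J N} {f h : N → ℝ} {x : N} (hf : MDifferentiableAt J 𝓘(ℝ, ℝ) f x)
    (hh : MDifferentiableAt J 𝓘(ℝ, ℝ) h x) :
    deriv J X (fun y => f y + h y) x = deriv J X f x + deriv J X h x := by
  have := (hf.hasMFDerivAt.add hh.hasMFDerivAt).mfderiv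
  unfold deriv
  exact congrArg (fun L : TangentSpace J x →L[ℝ] ℝ => L (X x)) this

lemma deriv_mul {X : VField J N} {f h : N → ℝ} {x : N} (hf : MDifferentiableAt J 𝓘(ℝ, ℝ) f x)
    (hh : MDifferentiableAt J 𝓘(ℝ, ℝ) h x) :
    deriv J X (fun y => f y * h y) x = f x * deriv J X h x + h x * deriv J X f x := by
  have := (hf.hasMFDerivAt.mul hh.hasMFDerivAt).mfderiv
  unfold deriv
  exact congrArg (fun L : TangentSpace J x →L[ℝ] ℝ => L (X x)) this

lemma mdifferentiableAt_sum {κ : Type*} {s : Finset κ} {f : κ → N → ℝ} {x : N}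
    (hf : ∀ i ∈ s, MDifferentiableAt J 𝓘(ℝ, ℝ) (f i) x) :
    MDifferentiableAt J 𝓘(ℝ, ℝ) (fun y => ∑ i ∈ s, f i y) x := by
  classical
  induction s using Finset.induction_on with
  | empty => simpa using mdifferentiableAt_const
  | insert a s ha ih =>
    simp only [Finset.sum_insert ha]
    exact (hf a (by simp)).add (ih fun i hi => hf i (by simp [hi]))

lemma deriv_sum {κ : Type*} {s : Finset κ} {X : VField J N} {f : κ → N → ℝ} {x : N}
    (hf : ∀ i ∈ s, MDifferentiableAt J 𝓘(ℝ, ℝ) (f i) x) :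
    deriv J X (fun y => ∑ i ∈ s, f i y) x = ∑ i ∈ s, deriv J X (f i) x := by
  classical
  induction s using Finset.induction_on with
  | empty => simp [deriv_const]
  | insert a s ha ih =>
    simp only [Finset.sum_insert ha]
    rw [deriv_add (hf a (by simp)) (mdifferentiableAt_sum fun i hi => hf i (by simp [hi])),
      ih fun i hi => hf i (by simp [hi])]

lemma deriv_combo (e : ι → VField J N) (a : N → ι → ℝ) (f : N → ℝ) (x : N) :
    deriv J (combo e a) f x = ∑ I, a x I * deriv J (e I) f x := by
  unfold deriv combo
  rw [map_sum]
  exact Finset.sum_congr rfl fun I _ => by rw [map_smul]; rfl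

lemma inner_combo (g : ∀ x : N, LinearMap.BilinForm ℝ (TangentSpace J x)) (e : ι → VField J N)
    (a b : N → ι → ℝ) (x : N) :
    inner g (combo e a) (combo e b) x = bil (gram g e x) (a x) (b x) := by
  simp only [inner, combo, bil_apply, gram, map_sum, map_smul, LinearMap.sum_apply,
    LinearMap.smul_apply, smul_eq_mul, Finset.mul_sum, mul_assoc]
  rw [Finset.sum_comm]
  exact Finset.sum_congr rfl fun I _ => Finset.sum_congr rfl fun K _ => by ring

lemma deriv_bil {X : VField J N} {G : N → ι → ι → ℝ} {a b : N → ι → ℝ} {x : N}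
    (hG : ∀ I K, MDifferentiableAt J 𝓘(ℝ, ℝ) (fun y => G y I K) x)
    (ha : ∀ I, MDifferentiableAt J 𝓘(ℝ, ℝ) (fun y => a y I) x)
    (hb : ∀ I, MDifferentiableAt J 𝓘(ℝ, ℝ) (fun y => b y I) x) :
    deriv J X (fun y => bil (G y) (a y) (b y)) x =
      bil (G x) (dvec X a x) (b x) + bil (G x) (a x) (dvec X b x)
        + bil (fun I K => deriv J X (fun y => G y I K) x) (a x) (b x) := by
  have h2 : ∀ I K, MDifferentiableAt J 𝓘(ℝ, ℝ) (fun y => a y I * b y K) x := fun I K =>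
    (ha I).mul (hb K)
  have h3 : ∀ I K, MDifferentiableAt J 𝓘(ℝ, ℝ) (fun y => a y I * b y K * G y I K) x :=
    fun I K => (h2 I K).mul (hG I K)
  simp only [bil_apply, dvec]
  rw [deriv_sum fun I _ => mdifferentiableAt_sum fun K _ => h3 I K]
  simp only [← Finset.sum_add_distrib]
  refine Finset.sum_congr rfl fun I _ => ?_
  rw [deriv_sum fun K _ => h3 I K]
  refine Finset.sum_congr rfl fun K _ => ?_
  rw [deriv_mul (h2 I K) (hG I K), deriv_mul (ha I) (hb K)]
  ring

lemma metric_sum_smul (g : ∀ x : N, LinearMap.BilinForm ℝ (TangentSpace J x))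
    (e : ι → VField J N) (x : N) (u v : ι → ℝ) :
    g x (∑ I, u I • e I x) (∑ I, v I • e I x) = bil (gram g e x) u v :=
  inner_combo g e (fun _ => u) (fun _ => v) x

lemma metric_sum_smul_left [DecidableEq ι] (g : ∀ x : N, LinearMap.BilinForm ℝ (TangentSpace J x))
    (e : ι → VField J N) (x : N) (u : ι → ℝ) (L : ι) :
    g x (∑ I, u I • e I x) (e L x) = bil (gram g e x) u (Pi.single L 1) := by
  rw [← metric_sum_smul]
  congr 1
  rw [Finset.sum_eq_single L]
  · simp
  · intro b _ hb; simp [hb]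
  · simp

/-- The Koszul expression depends only on the germs of the vector fields. -/
lemma koszul_congr {g : ∀ x : N, LinearMap.BilinForm ℝ (TangentSpace J x)}
    {X X' Y Y' W W' : VField J N} {x : N} (hX : X =ᶠ[𝓝 x] X')
    (hY : Y =ᶠ[𝓝 x] Y') (hW : W =ᶠ[𝓝 x] W') : koszul g X Y W x = koszul g X' Y' W' x := by
  have hin : ∀ {Y Y' W W' : VField J N}, Y =ᶠ[𝓝 x] Y' → W =ᶠ[𝓝 x] W' →
      inner g Y W =ᶠ[𝓝 x] inner g Y' W' := by
    intro Y Y' W W' hY hW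
    filter_upwards [hY, hW] with y h1 h2
    simp only [inner, h1, h2]
  have hbr : ∀ {Y Y' W W' : VField J N}, Y =ᶠ[𝓝 x] Y' → W =ᶠ[𝓝 x] W' →
      bracket J Y W x = bracket J Y' W' x := fun hY hW => hY.mlieBracket_vectorField_eq hW
  unfold koszul
  rw [deriv_congr hX.self_of_nhds (hin hY hW), deriv_congr hY.self_of_nhds (hin hX hW),
    deriv_congr hW.self_of_nhds (hin hX hY)]
  unfold inner
  rw [hbr hX hY, hbr hX hW, hbr hY hW, hX.self_of_nhds, hY.self_of_nhds, hW.self_of_nhds]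

variable [CompleteSpace E] [IsManifold J ∞ N]

/-- The Leibniz rule for the bracket with a combination of the frame. -/
lemma bracket_sum_right {X : VField J N} {e : ι → VField J N} {b : N → ι → ℝ} {x : N}
    (he : ∀ I, MDifferentiableAt J J.tangent (fun y => (⟨y, e I y⟩ : TangentBundle J N)) x)
    (hb : ∀ I, MDifferentiableAt J 𝓘(ℝ, ℝ) (fun y => b y I) x) :
    bracket J X (combo e b) x =
      ∑ K, (dvec X b x K • e K x + b x K • bracket J X (e K) x) := by
  classical
  have hm : ∀ K, MDifferentiableAt J J.tangent
      (fun y => (⟨y, b y K • e K y⟩ : TangentBundle J N)) x := fun K =>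
    MDifferentiableAt.smul_section (hb K) (he K)
  have key : ∀ s : Finset ι, VectorField.mlieBracket J X (fun y => ∑ K ∈ s, b y K • e K y) x =
      ∑ K ∈ s, (dvec X b x K • e K x + b x K • bracket J X (e K) x) := by
    intro s
    induction s using Finset.induction_on with
    | empty =>
      simp only [Finset.sum_empty]
      exact congrFun (VectorField.mlieBracket_zero_right (I := J) (W := X)) x
    | insert K s hK ih =>
      simp only [Finset.sum_insert hK]
      have h1 := VectorField.mlieBracket_add_right (I := J) (V := X) (x := x)
        (W := fun y => b y K • e K y) (W₁ := fun y => ∑ K ∈ s, b y K • e K y) (hm K)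
        (MDifferentiableAt.sum_section fun K _ => hm K)
      have h2 := VectorField.mlieBracket_smul_right (I := J) (V := X) (x := x) (hb K) (he K)
      refine h1.trans (congrArg₂ (· + ·) h2 ih)
  exact key Finset.univ

/-- The bracket of two vector fields with variable coefficients in a frame with structure
functions `c`. -/
lemma bracket_combo {e : ι → VField J N} {a b : N → ι → ℝ} {x : N} {c : ι → ι → ι → ℝ}
    (he : ∀ I, MDifferentiableAt J J.tangent (fun y => (⟨y, e I y⟩ : TangentBundle J N)) x)
    (ha : ∀ I, MDifferentiableAt J 𝓘(ℝ, ℝ) (fun y => a y I) x)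
    (hb : ∀ I, MDifferentiableAt J 𝓘(ℝ, ℝ) (fun y => b y I) x)
    (hc : ∀ I K, bracket J (e I) (e K) x = ∑ L, c I K L • e L x) :
    bracket J (combo e a) (combo e b) x =
      ∑ L, (tri c (a x) (b x) + dvec (combo e a) b x - dvec (combo e b) a x) L • e L x := by
  have swap : ∀ X Y : VField J N, bracket J X Y x = -bracket J Y X x := fun X Y =>
    VectorField.mlieBracket_swap_apply
  have h1 : ∀ K, bracket J (combo e a) (e K) x =
      ∑ I, (-(dvec (e K) a x I) • e I x + a x I • ∑ L, c I K L • e L x) := by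
    intro K
    rw [swap, bracket_sum_right he ha, ← Finset.sum_neg_distrib]
    refine Finset.sum_congr rfl fun I _ => ?_
    rw [swap (e K) (e I), hc]
    simp [add_comm]
  rw [bracket_sum_right he hb]
  simp only [h1, Pi.sub_apply, Pi.add_apply, sub_smul, add_smul, Finset.sum_add_distrib,
    Finset.sum_sub_distrib, smul_add, Finset.smul_sum, smul_smul, neg_smul, smul_neg,
    Finset.sum_neg_distrib]
  have h2 : ∑ K, ∑ I, (b x K * dvec (e K) a x I) • e I x = ∑ I, dvec (combo e b) a x I • e I x := by
    rw [Finset.sum_comm]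
    refine Finset.sum_congr rfl fun I _ => ?_
    rw [← Finset.sum_smul]
    simp only [dvec, deriv_combo]
  have h3 : ∑ K, ∑ I, ∑ L, (b x K * (a x I * c I K L)) • e L x
      = ∑ L, tri c (a x) (b x) L • e L x := by
    rw [Finset.sum_comm]
    simp only [tri_apply, Finset.sum_smul]
    symm
    rw [Finset.sum_comm]
    refine Finset.sum_congr rfl fun I _ => ?_
    rw [Finset.sum_comm]
    exact Finset.sum_congr rfl fun K _ => Finset.sum_congr rfl fun L _ => by congr 1; ring
  rw [h2, h3]
  abel

/-- The frame `e` over the open set `Ω` has structure functions `c`, and `g` is a smooth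
nondegenerate metric whose Christoffel symbols in this frame are `Γ`, that is,
`∇_{e I} (e K) = ∑ M, Γ I K M • e M`; this is expressed by the Koszul formula. -/
structure IsMetricFrame (g : ∀ x : N, LinearMap.BilinForm ℝ (TangentSpace J x))
    (e : ι → VField J N) (Ω : Set N) (c Γ : N → ι → ι → ι → ℝ) : Prop where
  isOpen : IsOpen Ω
  frame : IsLocalFrameOn J E ∞ e Ω
  bracket_eq : ∀ x ∈ Ω, ∀ I K, bracket J (e I) (e K) x = ∑ L, c x I K L • e L x
  symm : ∀ x ∈ Ω, ∀ v w, g x v w = g x w v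
  smooth_gram : ∀ I K, ContMDiffOn J 𝓘(ℝ, ℝ) ∞ (fun y => gram g e y I K) Ω
  det_ne_zero : ∀ x ∈ Ω, ∀ [DecidableEq ι], (Matrix.of (gram g e x)).det ≠ 0
  christoffel : ∀ x ∈ Ω, ∀ I K L,
    2 * ∑ M, Γ x I K M * gram g e x M L = koszul g (e I) (e K) (e L) x

section Koszul

variable {g : ∀ x : N, LinearMap.BilinForm ℝ (TangentSpace J x)} {e : ι → VField J N} {Ω : Set N}
  {c Γ : N → ι → ι → ι → ℝ}

/-- The Koszul expression is tensorial in its first and third argument, and a derivation in the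
second one. -/
lemma IsMetricFrame.koszul_combo (h : IsMetricFrame g e Ω c Γ) {x : N} (hx : x ∈ Ω)
    {a b w : N → ι → ℝ}
    (ha : ∀ I, MDifferentiableAt J 𝓘(ℝ, ℝ) (fun y => a y I) x)
    (hb : ∀ I, MDifferentiableAt J 𝓘(ℝ, ℝ) (fun y => b y I) x)
    (hw : ∀ I, MDifferentiableAt J 𝓘(ℝ, ℝ) (fun y => w y I) x) :
    koszul g (combo e a) (combo e b) (combo e w) x =
      2 * bil (gram g e x) (tri (Γ x) (a x) (b x) + dvec (combo e a) b x) (w x) := by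
  classical
  have he : ∀ I, MDifferentiableAt J J.tangent (fun y => (⟨y, e I y⟩ : TangentBundle J N)) x :=
    fun I => (h.frame.contMDiffAt h.isOpen hx I).mdifferentiableAt (by simp)
  have hG : ∀ I K, MDifferentiableAt J 𝓘(ℝ, ℝ) (fun y => gram g e y I K) x := fun I K =>
    ((h.smooth_gram I K).contMDiffAt (h.isOpen.mem_nhds hx)).mdifferentiableAt (by simp)
  have hs : ∀ u v, bil (gram g e x) u v = bil (gram g e x) v u :=
    bil_symm fun I K => h.symm x hx _ _
  let DG : ι → ι → ι → ℝ := fun I K L => deriv J (e I) (fun y => gram g e y K L) x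
  -- the part of the Koszul expression that does not contain derivatives of the coefficients
  let κ : (ι → ℝ) → (ι → ℝ) → (ι → ℝ) → ℝ := fun u v w =>
    ∑ I, u I * bil (DG I) v w + ∑ I, v I * bil (DG I) u w - ∑ I, w I * bil (DG I) u v
      + bil (gram g e x) (tri (c x) u v) w - bil (gram g e x) (tri (c x) u w) v
      - bil (gram g e x) (tri (c x) v w) u
  have hD : ∀ (p q r : N → ι → ℝ), bil (fun K L => deriv J (combo e p)
      (fun y => gram g e y K L) x) (q x) (r x) = ∑ I, p x I * bil (DG I) (q x) (r x) := by
    intro p q r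
    simp only [deriv_combo, bil_apply, Finset.mul_sum]
    rw [Finset.sum_comm' (t' := Finset.univ) (s' := fun _ => Finset.univ) (by simp)]
    simp only [DG]
    rw [Finset.sum_comm]
    conv_rhs => rw [Finset.sum_comm]
    refine Finset.sum_congr rfl fun K _ => ?_
    rw [Finset.sum_comm]
    exact Finset.sum_congr rfl fun L _ => Finset.sum_congr rfl fun I _ => by ring
  have h1 : koszul g (combo e a) (combo e b) (combo e w) x =
      2 * bil (gram g e x) (dvec (combo e a) b x) (w x) + κ (a x) (b x) (w x) := by
    have hin : ∀ p q : N → ι → ℝ, inner g (combo e p) (combo e q)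
        = fun y => bil (gram g e y) (p y) (q y) := fun p q => funext fun y => inner_combo g e p q y
    have hbr : ∀ {p q : N → ι → ℝ} (r : N → ι → ℝ),
        (∀ I, MDifferentiableAt J 𝓘(ℝ, ℝ) (fun y => p y I) x) →
        (∀ I, MDifferentiableAt J 𝓘(ℝ, ℝ) (fun y => q y I) x) →
        inner g (bracket J (combo e p) (combo e q)) (combo e r) x =
          bil (gram g e x)
            (tri (c x) (p x) (q x) + dvec (combo e p) q x - dvec (combo e q) p x) (r x) := by
      intro p q r hp hq
      unfold inner
      rw [bracket_combo he hp hq (h.bracket_eq x hx)]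
      exact metric_sum_smul g e x _ _
    unfold koszul
    rw [hbr w ha hb, hbr b ha hw, hbr a hb hw, hin, hin, hin, deriv_bil hG hb hw,
      deriv_bil hG ha hw, deriv_bil hG ha hb, hD, hD, hD]
    simp only [κ, map_add, map_sub, LinearMap.add_apply, LinearMap.sub_apply]
    rw [hs (b x) (dvec (combo e a) w x), hs (a x) (dvec (combo e b) w x),
      hs (a x) (dvec (combo e w) b x)]
    ring
  -- both sides are trilinear, so it suffices to consider the members of the frame
  have h2 : κ (a x) (b x) (w x) = 2 * bil (gram g e x) (tri (Γ x) (a x) (b x)) (w x) := by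
    refine eq_of_isLinearMap (f := fun u => κ u (b x) (w x))
      (f' := fun u => 2 * bil (gram g e x) (tri (Γ x) u (b x)) (w x)) ?_ ?_ (fun I => ?_) _
    · constructor <;> intros <;> simp [κ, add_mul, mul_add, Finset.sum_add_distrib, Finset.mul_sum,
        mul_sub, mul_assoc, mul_left_comm] <;> ring
    · constructor <;> intros <;> simp [mul_add]; ring
    refine eq_of_isLinearMap (f := fun u => κ (Pi.single I 1) u (w x))
      (f' := fun u => 2 * bil (gram g e x) (tri (Γ x) (Pi.single I 1) u) (w x)) ?_ ?_
      (fun K => ?_) _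
    · constructor <;> intros <;> simp [κ, add_mul, mul_add, Finset.sum_add_distrib, Finset.mul_sum,
        mul_sub, mul_assoc, mul_left_comm] <;> ring
    · constructor <;> intros <;> simp [mul_add]; ring
    refine eq_of_isLinearMap (f := fun u => κ (Pi.single I 1) (Pi.single K 1) u)
      (f' := fun u => 2 * bil (gram g e x) (tri (Γ x) (Pi.single I 1) (Pi.single K 1)) u) ?_ ?_
      (fun L => ?_) _
    · constructor <;> intros <;> simp [κ, add_mul, mul_add, Finset.sum_add_distrib, Finset.mul_sum,
        mul_sub, mul_assoc, mul_left_comm] <;> ring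
    · constructor <;> intros <;> simp [mul_add]; ring
    have hone : ∀ (I : ι) (f : ι → ℝ), ∑ K, (Pi.single I 1 : ι → ℝ) K * f K = f I := by
      intro I f
      rw [Finset.sum_eq_single I]
      · simp
      · intro b _ hb; simp [hb]
      · simp
    have hΓ := h.christoffel x hx I K L
    simp only [κ, hone, bil_single, tri_single, bil_single_right _ (Γ x I K), hΓ, koszul, inner,
      h.bracket_eq x hx, metric_sum_smul_left]
    rfl
  rw [h1, h2, map_add, LinearMap.add_apply]
  ring

variable [FiniteDimensional ℝ E]

/-- The Levi-Civita connection in terms of the Christoffel symbols. -/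
lemma IsMetricFrame.leviCivita_eq (h : IsMetricFrame g e Ω c Γ) {x : N} (hx : x ∈ Ω)
    {a b : N → ι → ℝ} {X Y : VField J N} (hX : X =ᶠ[𝓝 x] combo e a) (hY : Y =ᶠ[𝓝 x] combo e b)
    (ha : ∀ I, MDifferentiableAt J 𝓘(ℝ, ℝ) (fun y => a y I) x)
    (hb : ∀ I, MDifferentiableAt J 𝓘(ℝ, ℝ) (fun y => b y I) x) :
    leviCivita g X Y x =
      ∑ L, (tri (Γ x) (a x) (b x) + dvec (combo e a) b x) L • e L x := by
  classical
  set u : ι → ℝ := tri (Γ x) (a x) (b x) + dvec (combo e a) b x with hu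
  have hex : ∀ W : VField J N, SmoothFieldAt J W x →
      2 * g x (∑ L, u L • e L x) (W x) = koszul g X Y W x := by
    intro W hW
    have hWc : W =ᶠ[𝓝 x] combo e (fun y I => h.frame.coeff I y (W y)) := by
      filter_upwards [h.isOpen.mem_nhds hx] with y hy
      exact h.frame.coeff_sum_eq W hy
    rw [koszul_congr hX hY hWc, h.koszul_combo hx ha hb fun I =>
      (contMDiffAt_coeff h.frame h.isOpen hx hW I).mdifferentiableAt (by simp), ← hu,
      ← metric_sum_smul]
    congr 2
    exact hWc.self_of_nhds
  have huniq : ∀ v : TangentSpace J x, (∀ W : VField J N, SmoothFieldAt J W x →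
      2 * g x v (W x) = koszul g X Y W x) → v = ∑ L, u L • e L x := by
    intro v hv
    obtain ⟨p, hv'⟩ : ∃ p : ι → ℝ, v = ∑ L, p L • e L x :=
      ⟨(h.frame.toBasisAt hx).repr v, by
        simpa using ((h.frame.toBasisAt hx).sum_repr v).symm⟩
    have h0 : p - u = 0 := by
      refine eq_zero_of_bil_eq_zero (h.det_ne_zero x hx) fun L => ?_
      have h1 := hv (e L) (h.frame.contMDiffAt h.isOpen hx L)
      have h2 := hex (e L) (h.frame.contMDiffAt h.isOpen hx L)
      rw [hv', metric_sum_smul_left] at h1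
      rw [metric_sum_smul_left] at h2
      rw [map_sub, LinearMap.sub_apply]
      linarith
    rw [sub_eq_zero] at h0
    rw [hv', h0]
  have hE : ∃ v : TangentSpace J x, ∀ W : VField J N, SmoothFieldAt J W x →
      2 * g x v (W x) = koszul g X Y W x := ⟨_, hex⟩
  rw [leviCivita, dif_pos hE]
  exact huniq _ hE.choose_spec

end Koszul

end Frame

/-! ### The curvature tensor in a frame -/

section Riemann

variable {E : Type*} [NormedAddCommGroup E] [NormedSpace ℝ E]
  {H : Type*} [TopologicalSpace H] {J : ModelWithCorners ℝ E H}
  {N : Type*} [TopologicalSpace N] [ChartedSpace H N]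
  {ι : Type*} [Fintype ι] [IsManifold J ∞ N] [CompleteSpace E] [FiniteDimensional ℝ E]
  {g : ∀ x : N, LinearMap.BilinForm ℝ (TangentSpace J x)} {e : ι → VField J N} {Ω : Set N}
  {c Γ : N → ι → ι → ι → ℝ}

/-- The curvature tensor on vector fields with constant coefficients in the frame. -/
lemma IsMetricFrame.riemann_eq (h : IsMetricFrame g e Ω c Γ)
    (hc : ∀ I K L, ContMDiffOn J 𝓘(ℝ, ℝ) ∞ (fun y => c y I K L) Ω)
    (hΓ : ∀ I K L, ContMDiffOn J 𝓘(ℝ, ℝ) ∞ (fun y => Γ y I K L) Ω)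
    {x : N} (hx : x ∈ Ω) (a b u w : ι → ℝ) :
    riemann g (combo e fun _ => a) (combo e fun _ => b) (combo e fun _ => u)
        (combo e fun _ => w) x =
      bil (gram g e x)
        (tri (Γ x) a (tri (Γ x) b u) + dvec (combo e fun _ => a) (fun y => tri (Γ y) b u) x
          - (tri (Γ x) b (tri (Γ x) a u) + dvec (combo e fun _ => b) (fun y => tri (Γ y) a u) x)
          - tri (Γ x) (tri (c x) a b) u) w := by
  have hconst : ∀ (p : ι → ℝ) (y : N) (I : ι),
      MDifferentiableAt J 𝓘(ℝ, ℝ) (fun _ : N => p I) y := fun p y I => mdifferentiableAt_const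
  have hd0 : ∀ (X : VField J N) (p : ι → ℝ) (y : N), dvec X (fun _ => p) y = 0 := fun X p y =>
    funext fun I => deriv_const X (p I) y
  have htri : ∀ {A : N → ι → ι → ι → ℝ},
      (∀ I K L, ContMDiffOn J 𝓘(ℝ, ℝ) ∞ (fun y => A y I K L) Ω) → ∀ (p q : ι → ℝ) (L : ι),
      MDifferentiableAt J 𝓘(ℝ, ℝ) (fun y => tri (A y) p q L) x := by
    intro A hA p q L
    simp only [tri_apply]
    exact mdifferentiableAt_sum fun I _ => mdifferentiableAt_sum fun K _ =>
      mdifferentiableAt_const.mul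
        (((hA I K L).contMDiffAt (h.isOpen.mem_nhds hx)).mdifferentiableAt (by simp))
  have h1 : ∀ p q : ι → ℝ, leviCivita g (combo e fun _ => p) (combo e fun _ => q)
      =ᶠ[𝓝 x] combo e (fun y => tri (Γ y) p q) := by
    intro p q
    filter_upwards [h.isOpen.mem_nhds hx] with y hy
    rw [h.leviCivita_eq hy Filter.EventuallyEq.rfl Filter.EventuallyEq.rfl (hconst p y)
      (hconst q y), hd0, add_zero]
    rfl
  have h2 : bracket J (combo e fun _ => a) (combo e fun _ => b)
      =ᶠ[𝓝 x] combo e (fun y => tri (c y) a b) := by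
    filter_upwards [h.isOpen.mem_nhds hx] with y hy
    rw [bracket_combo (fun I => (h.frame.contMDiffAt h.isOpen hy I).mdifferentiableAt (by simp))
      (hconst a y) (hconst b y) (h.bracket_eq y hy), hd0, hd0, add_zero, sub_zero]
    rfl
  unfold riemann
  rw [h.leviCivita_eq hx Filter.EventuallyEq.rfl (h1 b u) (hconst a x) (htri hΓ b u),
    h.leviCivita_eq hx Filter.EventuallyEq.rfl (h1 a u) (hconst b x) (htri hΓ a u),
    h.leviCivita_eq hx h2 Filter.EventuallyEq.rfl (htri hc a b) (hconst u x), hd0, add_zero,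
    ← Finset.sum_sub_distrib, ← Finset.sum_sub_distrib]
  simp only [← sub_smul]
  exact metric_sum_smul g e x _ w

end Riemann

/-! ### The model Lie algebra of complex hyperbolic space -/

section Model

variable {W κ : Type*} [AddCommGroup W] [Module ℂ W]

/-- A complex vector space with a frame `v` indexed by `{τ, α, τ̄, ᾱ}`, a skew bracket `br`, a
metric `met` and its Levi-Civita product `nab`, which have the structure constants
of the solvable Lie algebra of complex hyperbolic space, for a Levi form `h` of any signature. -/
structure IsHyperbolicModel (met : W →ₗ[ℂ] W →ₗ[ℂ] ℂ) (br nab : W →ₗ[ℂ] W →ₗ[ℂ] W)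
    (v : Option κ × Bool → W) (h : κ → κ → ℂ) : Prop where
  symm : ∀ u w, met u w = met w u
  nondegenerate : ∀ u, (∀ P, met u (v P) = 0) → u = 0
  koszul : ∀ u w z, 2 * met (nab u w) z = met (br u w) z - met (br u z) w - met (br w z) u
  met_same : ∀ A B s, met (v (A, s)) (v (B, s)) = 0
  met_tau_tau : met (v (none, false)) (v (none, true)) = 2
  met_tau_hor : ∀ α s, met (v (none, s)) (v (some α, !s)) = 0
  met_hor_hor : ∀ α β, met (v (some α, false)) (v (some β, true)) = h α β
  skew : ∀ u w, br u w = -br w u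
  br_tau_tau : br (v (none, false)) (v (none, true)) = v (none, true) - v (none, false)
  br_tau_hor : ∀ α s t, br (v (none, s)) (v (some α, t)) = (1 / 2 : ℂ) • v (some α, t)
  br_same : ∀ α β s, br (v (some α, s)) (v (some β, s)) = 0
  br_hor_hor : ∀ α β, br (v (some α, false)) (v (some β, true)) =
    (h α β / 2) • (v (none, true) - v (none, false))

/-- The Levi-Civita product of the model on the frame. It preserves the type of the second
argument. -/
def modelConnection (v : Option κ × Bool → W) (h : κ → κ → ℂ) :
    Option κ × Bool → Option κ × Bool → W
  | (none, s), (none, t) => if s = t then -v (none, t) else v (none, t)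
  | (none, s), (some β, t) => (if s = t then -(1 / 2) else 1 / 2 : ℂ) • v (some β, t)
  | (some α, s), (none, t) => if s = t then -v (some α, t) else 0
  | (some α, s), (some β, t) =>
    if s = t then 0 else ((if t then h α β else h β α) / 2) • v (none, t)

namespace IsHyperbolicModel

variable {met : W →ₗ[ℂ] W →ₗ[ℂ] ℂ} {br nab : W →ₗ[ℂ] W →ₗ[ℂ] W} {v : Option κ × Bool → W}
  {h : κ → κ → ℂ} (hm : IsHyperbolicModel met br nab v h)

include hm

/-- The components of the metric. -/
lemma met_eq (A B : Option κ) (s t : Bool) : met (v (A, s)) (v (B, t)) =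
    if s = t then 0 else match A, B with
      | none, none => 2
      | some α, some β => if t then h α β else h β α
      | _, _ => 0 := by
  have h1 := hm.met_same
  have h2 := hm.met_tau_tau
  have h3 := hm.met_hor_hor
  have h4 := fun α => hm.met_tau_hor α false
  have h5 := fun α => hm.met_tau_hor α true
  have h6 := fun α => (hm.symm _ _).trans (h4 α)
  have h7 := fun α => (hm.symm _ _).trans (h5 α)
  have h8 := (hm.symm _ _).trans h2
  have h9 := fun α β => (hm.symm _ _).trans (h3 α β)
  rcases A with _ | α <;> rcases B with _ | β <;> rcases s <;> rcases t <;> simp_all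

/-- The brackets of the frame. -/
lemma br_eq (A B : Option κ) (s t : Bool) : br (v (A, s)) (v (B, t)) =
    match A, B with
      | none, none => if s = t then 0 else v (none, t) - v (none, s)
      | none, some β => (1 / 2 : ℂ) • v (some β, t)
      | some α, none => -((1 / 2 : ℂ) • v (some α, s))
      | some α, some β => if s = t then 0 else
          ((if t then h α β else h β α) / 2) • (v (none, t) - v (none, s)) := by
  have h0 : ∀ u, br u u = 0 := fun u => by
    have h2 : (2 : ℂ) • br u u = 0 := by
      rw [two_smul]; nth_rewrite 1 [hm.skew u u]; simp
    simpa using h2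
  rcases A with _ | α <;> rcases B with _ | β
  · rcases s <;> rcases t <;> simp [h0, hm.br_tau_tau]
    rw [hm.skew, hm.br_tau_tau]; abel
  · exact hm.br_tau_hor β s t
  · rw [hm.skew, hm.br_tau_hor]
  · rcases s <;> rcases t <;> simp [hm.br_same, hm.br_hor_hor]
    rw [hm.skew, hm.br_hor_hor, ← smul_neg, neg_sub]

/-- The candidate `modelConnection` satisfies the Koszul formula, and the metric is
nondegenerate. -/
lemma nab_eq (P Q : Option κ × Bool) : nab (v P) (v Q) = modelConnection v h P Q := by
  rw [← sub_eq_zero]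
  refine hm.nondegenerate _ fun R => ?_
  have hk := hm.koszul (v P) (v Q) (v R)
  rw [map_sub, LinearMap.sub_apply, sub_eq_zero]
  refine mul_left_cancel₀ (two_ne_zero (α := ℂ)) (hk.trans ?_)
  obtain ⟨A, s⟩ := P
  obtain ⟨B, t⟩ := Q
  obtain ⟨C, r⟩ := R
  rw [hm.br_eq, hm.br_eq, hm.br_eq]
  rcases A with _ | α <;> rcases B with _ | β <;> rcases C with _ | γ <;> rcases s <;>
    rcases t <;> rcases r <;> simp [modelConnection, hm.met_eq] <;> ring

/-- The curvature tensor of the model. -/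
lemma curvature_eq (P Q R T : Option κ × Bool) :
    met (nab (v P) (nab (v Q) (v R)) - nab (v Q) (nab (v P) (v R)) - nab (br (v P) (v Q)) (v R))
        (v T) =
      if P.2 = Q.2 ∨ R.2 = T.2 then 0 else
        (if Q.2 = R.2 then 1 else -1 : ℂ) / 2 *
          (met (v P) (v Q) * met (v R) (v T) +
            if Q.2 = R.2 then met (v P) (v R) * met (v Q) (v T)
            else met (v P) (v T) * met (v R) (v Q)) := by
  obtain ⟨A, s⟩ := P
  obtain ⟨B, t⟩ := Q
  obtain ⟨C, r⟩ := R
  obtain ⟨D, q⟩ := T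
  rw [hm.br_eq]
  rcases A with _ | α <;> rcases B with _ | β <;> rcases C with _ | γ <;> rcases D with _ | δ <;>
    rcases s <;> rcases t <;> rcases r <;> rcases q <;>
    simp [modelConnection, hm.nab_eq, hm.met_eq] <;> ring

end IsHyperbolicModel

end Model

/-! ### Brackets on the product `M × ℝ` -/

section Product

variable {n : ℕ} {M : Type*} [TopologicalSpace M] [ChartedSpace (Model n) M]

/-- The vector field on `M × ℝ` with `M`-component `X` and constant `∂_ρ`-component `a`. -/
def lift (X : VField (𝓡 (2 * n + 1)) M) (a : ℝ) : VField (prodModel n) (M × ℝ) :=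
  fun x => mkVec x (X x.1) a

variable [IsManifold (𝓡 (2 * n + 1)) ∞ M]

/-- The differential of a product chart acts on the two components separately. -/
lemma mfderiv_extChartAt_mkVec {x y : M × ℝ}
    (hy : y.1 ∈ (extChartAt (𝓡 (2 * n + 1)) x.1).source)
    (u : TangentSpace (𝓡 (2 * n + 1)) y.1) (s : ℝ) :
    mfderiv (prodModel n) 𝓘(ℝ, Model n × ℝ) (extChartAt (prodModel n) x) y (mkVec y u s) =
      ((mfderiv (𝓡 (2 * n + 1)) 𝓘(ℝ, Model n) (extChartAt (𝓡 (2 * n + 1)) x.1) y.1 u, s) :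
        Model n × ℝ) := by
  have h1 : (extChartAt (prodModel n) x : M × ℝ → Model n × ℝ) =
      fun y => (extChartAt (𝓡 (2 * n + 1)) x.1 y.1, y.2) := by
    rw [extChartAt_prod]; rfl
  have h2 : HasMFDerivAt (𝓡 (2 * n + 1)) 𝓘(ℝ, Model n) (extChartAt (𝓡 (2 * n + 1)) x.1) y.1
      (mfderiv (𝓡 (2 * n + 1)) 𝓘(ℝ, Model n) (extChartAt (𝓡 (2 * n + 1)) x.1) y.1) :=
    (mdifferentiableAt_extChartAt (by simpa using hy)).hasMFDerivAt
  have h3 := (h2.comp y (hasMFDerivAt_fst (I := 𝓡 (2 * n + 1)) (I' := 𝓘(ℝ, ℝ)) y)).prodMk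
    (hasMFDerivAt_snd (I := 𝓡 (2 * n + 1)) (I' := 𝓘(ℝ, ℝ)) y)
  rw [h1, modelWithCornersSelf_prod, ← chartedSpaceSelf_prod]
  exact congrArg (fun L : Model n × ℝ →L[ℝ] Model n × ℝ => L (u, s)) h3.mfderiv

/-- A lifted vector field in the product chart. -/
lemma mpullbackWithin_lift (X : VField (𝓡 (2 * n + 1)) M) (a : ℝ) (x : M × ℝ)
    {z : Model n × ℝ} (hz : z.1 ∈ (extChartAt (𝓡 (2 * n + 1)) x.1).target) :
    VectorField.mpullbackWithin 𝓘(ℝ, Model n × ℝ) (prodModel n) (extChartAt (prodModel n) x).symm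
      (lift X a) (Set.range (prodModel n)) z =
    ((VectorField.mpullbackWithin 𝓘(ℝ, Model n) (𝓡 (2 * n + 1))
      (extChartAt (𝓡 (2 * n + 1)) x.1).symm X (Set.range (𝓡 (2 * n + 1))) z.1, a) :
        Model n × ℝ) := by
  have hz' : z ∈ (extChartAt (prodModel n) x).target := by
    rw [extChartAt_prod]
    exact ⟨hz, by simp [chartAt_self_eq]⟩
  -- the differentials of a chart and of its inverse are inverse to each other
  have inv1 : ∀ w, (mfderivWithin 𝓘(ℝ, Model n × ℝ) (prodModel n)
      (extChartAt (prodModel n) x).symm (Set.range (prodModel n)) z).inverse w =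
      mfderiv (prodModel n) 𝓘(ℝ, Model n × ℝ) (extChartAt (prodModel n) x)
        ((extChartAt (prodModel n) x).symm z) w := fun w => by
    rw [ContinuousLinearMap.inverse_eq
      (mfderivWithin_extChartAt_symm_comp_mfderiv_extChartAt hz')
      (mfderiv_extChartAt_comp_mfderivWithin_extChartAt_symm hz')]
    rfl
  have inv2 : ∀ w, (mfderivWithin 𝓘(ℝ, Model n) (𝓡 (2 * n + 1))
      (extChartAt (𝓡 (2 * n + 1)) x.1).symm (Set.range (𝓡 (2 * n + 1))) z.1).inverse w =
      mfderiv (𝓡 (2 * n + 1)) 𝓘(ℝ, Model n) (extChartAt (𝓡 (2 * n + 1)) x.1)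
        ((extChartAt (𝓡 (2 * n + 1)) x.1).symm z.1) w := fun w => by
    rw [ContinuousLinearMap.inverse_eq
      (mfderivWithin_extChartAt_symm_comp_mfderiv_extChartAt hz)
      (mfderiv_extChartAt_comp_mfderivWithin_extChartAt_symm hz)]
    rfl
  rw [VectorField.mpullbackWithin_apply, VectorField.mpullbackWithin_apply]
  refine (inv1 _).trans ?_
  have hsymm : ((extChartAt (prodModel n) x).symm z).1 =
      (extChartAt (𝓡 (2 * n + 1)) x.1).symm z.1 := by
    rw [extChartAt_prod]; rfl
  refine (mfderiv_extChartAt_mkVec (x := x) (by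
    rw [hsymm]; exact (extChartAt (𝓡 (2 * n + 1)) x.1).map_target hz) _ _).trans ?_
  refine Prod.ext ?_ rfl
  refine Eq.trans ?_ (inv2 _).symm
  simp only
  rw [hsymm]

/-- The bracket of two lifted vector fields is the lift of their bracket. Both brackets are computed
in the product chart. -/
lemma bracket_lift {X Y : VField (𝓡 (2 * n + 1)) M} (a b : ℝ) {x : M × ℝ}
    (hX : SmoothFieldAt _ X x.1) (hY : SmoothFieldAt _ Y x.1) :
    bracket (prodModel n) (lift X a) (lift Y b) x = mkVec x (bracket _ X Y x.1) 0 := by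
  have htgt : ∀ᶠ z : Model n × ℝ in 𝓝 (extChartAt (prodModel n) x x),
      z.1 ∈ (extChartAt (𝓡 (2 * n + 1)) x.1).target := by
    have h1 : ContinuousAt (Prod.fst : Model n × ℝ → Model n) (extChartAt (prodModel n) x x) :=
      continuousAt_fst
    refine h1.eventually ?_
    have h2 : (extChartAt (prodModel n) x x).1 = extChartAt (𝓡 (2 * n + 1)) x.1 x.1 := by
      rw [extChartAt_prod]; rfl
    rw [h2]
    exact extChartAt_target_mem_nhds x.1
  have hfst : (extChartAt (prodModel n) x x).1 = extChartAt (𝓡 (2 * n + 1)) x.1 x.1 := by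
    rw [extChartAt_prod]; rfl
  have hrange' : (extChartAt (𝓡 (2 * n + 1)) x.1).symm ⁻¹' Set.univ ∩
      Set.range (𝓡 (2 * n + 1)) = Set.univ := by simp
  let X' : Model n → Model n := VectorField.mpullbackWithin 𝓘(ℝ, Model n) (𝓡 (2 * n + 1))
      (extChartAt (𝓡 (2 * n + 1)) x.1).symm X (Set.range (𝓡 (2 * n + 1)))
  let Y' : Model n → Model n := VectorField.mpullbackWithin 𝓘(ℝ, Model n) (𝓡 (2 * n + 1))
      (extChartAt (𝓡 (2 * n + 1)) x.1).symm Y (Set.range (𝓡 (2 * n + 1)))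
  have hdiff : ∀ {X : VField (𝓡 (2 * n + 1)) M}, SmoothFieldAt _ X x.1 →
      DifferentiableAt ℝ (VectorField.mpullbackWithin 𝓘(ℝ, Model n) (𝓡 (2 * n + 1))
      (extChartAt (𝓡 (2 * n + 1)) x.1).symm X (Set.range (𝓡 (2 * n + 1))) : Model n → Model n)
      (extChartAt (prodModel n) x x).1 := by
    intro X hX
    rw [hfst]
    have := MDifferentiableWithinAt.differentiableWithinAt_mpullbackWithin_vectorField
      (s := Set.univ) (hX.mdifferentiableAt (by simp)).mdifferentiableWithinAt
    rw [hrange'] at this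
    exact differentiableWithinAt_univ.1 this
  have hX' : (VectorField.mpullbackWithin 𝓘(ℝ, Model n × ℝ) (prodModel n)
      (extChartAt (prodModel n) x).symm (lift X a) (Set.range (prodModel n)) :
      Model n × ℝ → Model n × ℝ) =ᶠ[𝓝 (extChartAt (prodModel n) x x)] fun z => (X' z.1, a) := by
    filter_upwards [htgt] with z hz
    exact mpullbackWithin_lift X a x hz
  have hY' : (VectorField.mpullbackWithin 𝓘(ℝ, Model n × ℝ) (prodModel n)
      (extChartAt (prodModel n) x).symm (lift Y b) (Set.range (prodModel n)) :
      Model n × ℝ → Model n × ℝ) =ᶠ[𝓝 (extChartAt (prodModel n) x x)] fun z => (Y' z.1, b) := by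
    filter_upwards [htgt] with z hz
    exact mpullbackWithin_lift Y b x hz
  have hder : ∀ {F : Model n → Model n} (r : ℝ) (v : Model n × ℝ),
      DifferentiableAt ℝ F (extChartAt (prodModel n) x x).1 →
      fderiv ℝ (fun z : Model n × ℝ => (F z.1, r)) (extChartAt (prodModel n) x x) v =
        (fderiv ℝ F (extChartAt (prodModel n) x x).1 v.1, 0) := by
    intro F r v hF
    have h1 : HasFDerivAt (fun z : Model n × ℝ => (F z.1, r)) _ (extChartAt (prodModel n) x x) :=
      (hF.hasFDerivAt.comp (extChartAt (prodModel n) x x) hasFDerivAt_fst).prodMk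
        (hasFDerivAt_const r _)
    rw [h1.fderiv]
    rfl
  have hlie : (VectorField.lieBracket ℝ (fun z : Model n × ℝ => (X' z.1, a))
      (fun z : Model n × ℝ => (Y' z.1, b)) (extChartAt (prodModel n) x x)) =
      (VectorField.lieBracket ℝ X' Y' (extChartAt (𝓡 (2 * n + 1)) x.1 x.1), 0) := by
    simp only [VectorField.lieBracket_eq]
    refine (congrArg₂ (· - ·) (hder b _ (hdiff hY)) (hder a _ (hdiff hX))).trans ?_
    rw [hfst]
    exact Prod.ext rfl (sub_zero _)
  have hrange : (extChartAt (prodModel n) x).symm ⁻¹' Set.univ ∩ Set.range (prodModel n) =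
      Set.univ := by simp
  have hi := isInvertible_mfderiv_extChartAt (I := prodModel n) (mem_extChartAt_source x)
  have hi' := isInvertible_mfderiv_extChartAt (I := 𝓡 (2 * n + 1)) (mem_extChartAt_source x.1)
  have hL : VectorField.lieBracketWithin ℝ
      (VectorField.mpullbackWithin 𝓘(ℝ, Model n × ℝ) (prodModel n)
        (extChartAt (prodModel n) x).symm (lift X a) (Set.range (prodModel n)) :
        Model n × ℝ → Model n × ℝ)
      (VectorField.mpullbackWithin 𝓘(ℝ, Model n × ℝ) (prodModel n)
        (extChartAt (prodModel n) x).symm (lift Y b) (Set.range (prodModel n)) :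
        Model n × ℝ → Model n × ℝ)
      ((extChartAt (prodModel n) x).symm ⁻¹' Set.univ ∩ Set.range (prodModel n))
      (extChartAt (prodModel n) x x) =
      (VectorField.lieBracket ℝ X' Y' (extChartAt (𝓡 (2 * n + 1)) x.1 x.1), 0) := by
    have aux : ∀ {A B : Model n × ℝ → Model n × ℝ},
        A =ᶠ[𝓝 (extChartAt (prodModel n) x x)] (fun z => (X' z.1, a)) →
        B =ᶠ[𝓝 (extChartAt (prodModel n) x x)] (fun z => (Y' z.1, b)) →
        VectorField.lieBracketWithin ℝ A B Set.univ (extChartAt (prodModel n) x x) =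
        (VectorField.lieBracket ℝ X' Y' (extChartAt (𝓡 (2 * n + 1)) x.1 x.1), 0) := by
      intro A B hA hB
      rw [VectorField.lieBracketWithin_univ, hA.lieBracket_vectorField_eq hB, hlie]
    rw [hrange]
    exact aux hX' hY'
  let L : Model n := VectorField.lieBracket ℝ X' Y' (extChartAt (𝓡 (2 * n + 1)) x.1 x.1)
  have hL' : bracket (𝓡 (2 * n + 1)) X Y x.1 =
      (mfderiv (𝓡 (2 * n + 1)) 𝓘(ℝ, Model n) (extChartAt (𝓡 (2 * n + 1)) x.1) x.1).inverse
        L := by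
    have hL0 : L = VectorField.lieBracketWithin ℝ X' Y'
        ((extChartAt (𝓡 (2 * n + 1)) x.1).symm ⁻¹' Set.univ ∩ Set.range (𝓡 (2 * n + 1)))
        (extChartAt (𝓡 (2 * n + 1)) x.1 x.1) := by
      rw [hrange', VectorField.lieBracketWithin_univ]
    rw [hL0]
    rfl
  refine (hi.inverse_apply_eq).2 (hL.trans ?_)
  refine Eq.trans ?_ (mfderiv_extChartAt_mkVec (mem_extChartAt_source x.1) _ _).symm
  exact Prod.ext (hi'.inverse_apply_eq.1 hL'.symm) rfl

end Product

/-! ### The frame of the `Θ`-tangent bundle over a product -/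

section ThetaFrame

variable {n : ℕ} {M : Type*} [TopologicalSpace M] [ChartedSpace (Model n) M]

/-- The order of vanishing in `ρ`, minus one, of the fields of the `Θ`-frame. -/
def weight (n : ℕ) : Unit ⊕ Unit ⊕ Fin (2 * n) → ℕ :=
  Sum.elim (fun _ => 0) (Sum.elim (fun _ => 1) (fun _ => 0))

/-- The `∂_ρ`-component of the fields of the adapted frame. -/
def rhoCoeff (n : ℕ) : Unit ⊕ Unit ⊕ Fin (2 * n) → ℝ := Sum.elim (fun _ => 1) (fun _ => 0)

/-- The `M`-components of the fields of the adapted frame that is given by a frame `f = (T, Yᵢ)`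
of `TM`. -/
def horField (f : Unit ⊕ Fin (2 * n) → VField (𝓡 (2 * n + 1)) M) :
    Unit ⊕ Unit ⊕ Fin (2 * n) → VField (𝓡 (2 * n + 1)) M := Sum.elim (fun _ => 0) f

/-- The frame `ρ∂_ρ, ρ²T, ρYᵢ` that is given by a frame `f = (T, Yᵢ)` of `TM`. -/
def prodThetaFrame (f : Unit ⊕ Fin (2 * n) → VField (𝓡 (2 * n + 1)) M) :
    Unit ⊕ Unit ⊕ Fin (2 * n) → VField (prodModel n) (M × ℝ) :=
  thetaFrame (lift 0 1) (lift (f (Sum.inl ())) 0) (fun i => lift (f (Sum.inr i)) 0)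

lemma prodThetaFrame_eq (f : Unit ⊕ Fin (2 * n) → VField (𝓡 (2 * n + 1)) M)
    (I : Unit ⊕ Unit ⊕ Fin (2 * n)) :
    prodThetaFrame f I =
      fun x => x.2 ^ (weight n I + 1) • lift (horField f I) (rhoCoeff n I) x := by
  rcases I with _ | _ | i <;> funext x <;>
    simp [prodThetaFrame, thetaFrame, weight, horField, rhoCoeff]

lemma prodThetaFrame_apply (f : Unit ⊕ Fin (2 * n) → VField (𝓡 (2 * n + 1)) M)
    (I : Unit ⊕ Unit ⊕ Fin (2 * n)) (x : M × ℝ) :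
    prodThetaFrame f I x = x.2 ^ (weight n I + 1) • lift (horField f I) (rhoCoeff n I) x := by
  rw [prodThetaFrame_eq]

lemma prodThetaFrame_boundary (f : Unit ⊕ Fin (2 * n) → VField (𝓡 (2 * n + 1)) M)
    (I : Unit ⊕ Unit ⊕ Fin (2 * n)) (p : M) : prodThetaFrame f I (p, 0) = 0 := by
  rw [prodThetaFrame_apply]
  simp

/-- The lifts of a frame of `TM` are, together with `∂_ρ`, linearly independent, and so are their
multiples by nonzero numbers. -/
lemma linearIndependent_smul_lift {f : Unit ⊕ Fin (2 * n) → VField (𝓡 (2 * n + 1)) M} {x : M × ℝ}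
    (hf : LinearIndependent ℝ fun k => f k x.1) {r : Unit ⊕ Unit ⊕ Fin (2 * n) → ℝ}
    (hr : ∀ I, r I ≠ 0) :
    LinearIndependent ℝ fun I => r I • lift (horField f I) (rhoCoeff n I) x := by
  rw [Fintype.linearIndependent_iff] at hf ⊢
  intro u hu
  have h1 : ∑ k, (u (Sum.inr k) * r (Sum.inr k)) • f k x.1 = 0 := by
    have h := congrArg (LinearMap.fst ℝ (Model n) ℝ) hu
    erw [map_sum, Fintype.sum_sum_type] at h
    refine Eq.trans ?_ h
    erw [Finset.sum_eq_zero (s := (Finset.univ : Finset Unit)), zero_add]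
    · exact Finset.sum_congr rfl fun k _ => mul_smul _ _ _
    · intro k _
      erw [map_smul, map_smul]
      exact (congrArg (u _ • r _ • ·) (show LinearMap.fst ℝ (Model n) ℝ
        (lift (horField f (Sum.inl k)) (rhoCoeff n (Sum.inl k)) x) = 0 from rfl)).trans (by simp)
  have h2 : u (Sum.inl ()) * r (Sum.inl ()) = 0 := by
    have h := congrArg (LinearMap.snd ℝ (Model n) ℝ) hu
    erw [map_sum, Fintype.sum_sum_type] at h
    refine Eq.trans ?_ h
    erw [Finset.sum_eq_zero (s := (Finset.univ : Finset (Unit ⊕ Fin (2 * n)))), add_zero]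
    · rw [Finset.univ_unique, Finset.sum_singleton]
      erw [map_smul, map_smul]
      change _ = u _ * (r _ * 1)
      rw [mul_one]
    · intro k _
      erw [map_smul, map_smul]
      change u _ * (r _ * 0) = 0
      simp
  rintro (⟨⟩ | k)
  · exact (mul_eq_zero.1 h2).resolve_right (hr _)
  · exact (mul_eq_zero.1 (hf _ h1 k)).resolve_right (hr _)

lemma contMDiff_rho_pow (k : ℕ) :
    ContMDiff (prodModel n) 𝓘(ℝ, ℝ) ∞ (fun x : M × ℝ => x.2 ^ k) :=
  ContMDiff.comp (contDiff_id.pow k).contMDiff contMDiff_snd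

lemma deriv_rho_pow (X : VField (𝓡 (2 * n + 1)) M) (a : ℝ) (k : ℕ) (x : M × ℝ) :
    deriv (prodModel n) (lift X a) (fun x => x.2 ^ (k + 1)) x = a * ((k + 1) * x.2 ^ k) := by
  have h1 : HasMFDerivAt 𝓘(ℝ, ℝ) 𝓘(ℝ, ℝ) (fun s : ℝ => s ^ (k + 1)) x.2 _ :=
    (hasDerivAt_pow (k + 1) x.2).hasFDerivAt.hasMFDerivAt
  have h2 := (HasMFDerivAt.comp x h1
    (hasMFDerivAt_snd (I := 𝓡 (2 * n + 1)) (I' := 𝓘(ℝ, ℝ)) x)).mfderiv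
  refine (congrArg (fun L : Model n × ℝ →L[ℝ] ℝ => L (X x.1, a)) h2).trans ?_
  refine (ContinuousLinearMap.toSpanSingleton_apply ..).trans ?_
  simp only [Nat.add_sub_cancel, Nat.cast_add, Nat.cast_one]
  rfl

variable [IsManifold (𝓡 (2 * n + 1)) ∞ M]

lemma smoothFieldAt_lift {X : VField (𝓡 (2 * n + 1)) M} (a : ℝ) {x : M × ℝ}
    (hX : SmoothFieldAt _ X x.1) : SmoothFieldAt (prodModel n) (lift X a) x := by
  have h1 : ContMDiffAt (prodModel n) (𝓡 (2 * n + 1)).tangent ∞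
      (fun y : M × ℝ => (⟨y.1, X y.1⟩ : TangentBundle (𝓡 (2 * n + 1)) M)) x :=
    ContMDiffAt.comp x hX contMDiffAt_fst
  have h2 : ContMDiffAt (prodModel n) 𝓘(ℝ, ℝ).tangent ∞
      (fun y : M × ℝ => (⟨y.2, a⟩ : TangentBundle 𝓘(ℝ, ℝ) ℝ)) x := by
    have h3 : ContMDiffAt 𝓘(ℝ, ℝ) 𝓘(ℝ, ℝ).tangent ∞
        (fun s : ℝ => (⟨s, a⟩ : TangentBundle 𝓘(ℝ, ℝ) ℝ)) x.2 :=
      contMDiffAt_vectorSpace_iff_contDiffAt.2 contDiffAt_const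
    exact ContMDiffAt.comp x h3 contMDiffAt_snd
  exact (contMDiff_equivTangentBundleProd_symm.contMDiffAt).comp x (h1.prodMk h2)

/-- The bracket of two lifted fields, multiplied with powers of `ρ`. -/
lemma bracket_rho_smul_lift {X Y : VField (𝓡 (2 * n + 1)) M} (a b : ℝ) (v w : ℕ) {x : M × ℝ}
    (hX : SmoothFieldAt _ X x.1) (hY : SmoothFieldAt _ Y x.1) :
    bracket (prodModel n) (fun x => x.2 ^ (v + 1) • lift X a x)
        (fun x => x.2 ^ (w + 1) • lift Y b x) x =
      (x.2 ^ (v + 1) * x.2 ^ (w + 1)) • lift (bracket _ X Y) 0 x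
        + (x.2 ^ (v + 1) * (a * ((w + 1) * x.2 ^ w))) • lift Y b x
        - (x.2 ^ (w + 1) * (b * ((v + 1) * x.2 ^ v))) • lift X a x := by
  have hr : ∀ k : ℕ, MDifferentiableAt (prodModel n) 𝓘(ℝ, ℝ) (fun x : M × ℝ => x.2 ^ k) x :=
    fun k => (contMDiff_rho_pow k).contMDiffAt.mdifferentiableAt (by simp)
  have hl : ∀ {X : VField (𝓡 (2 * n + 1)) M} (a : ℝ), SmoothFieldAt _ X x.1 →
      MDifferentiableAt (prodModel n) (prodModel n).tangent
        (fun y => (⟨y, lift X a y⟩ : TangentBundle (prodModel n) (M × ℝ))) x := fun a hX =>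
    (smoothFieldAt_lift a hX).mdifferentiableAt (by simp)
  have h1 := VectorField.mlieBracket_smul_right (I := prodModel n)
    (V := fun x : M × ℝ => x.2 ^ (v + 1) • lift X a x) (hr (w + 1)) (hl b hY)
  have h2 := VectorField.mlieBracket_smul_left (I := prodModel n)
    (W := lift Y b) (hr (v + 1)) (hl a hX)
  have h3 := bracket_lift a b hX hY
  have hd : mvfderiv (prodModel n) (fun x : M × ℝ => x.2 ^ (w + 1)) x
      (x.2 ^ (v + 1) • lift X a x) = x.2 ^ (v + 1) * (a * ((w + 1) * x.2 ^ w)) := by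
    rw [map_smul]
    exact congrArg (x.2 ^ (v + 1) * ·) (deriv_rho_pow X a w x)
  have hd' : mvfderiv (prodModel n) (fun x : M × ℝ => x.2 ^ (v + 1)) x
      (lift Y b x) = b * ((v + 1) * x.2 ^ v) := deriv_rho_pow Y b v x
  refine h1.trans ?_
  rw [hd]
  refine (congrArg (fun t => _ + x.2 ^ (w + 1) • t) h2).trans ?_
  rw [hd']
  refine (congrArg (fun t => _ + x.2 ^ (w + 1) • (_ + x.2 ^ (v + 1) • t)) h3).trans ?_
  change _ + x.2 ^ (w + 1) • (_ + x.2 ^ (v + 1) • lift (bracket _ X Y) 0 x) = _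
  simp only [smul_add, smul_smul, neg_smul, smul_neg]
  rw [mul_comm (x.2 ^ (v + 1)) (x.2 ^ (w + 1))]
  abel

variable {f : Unit ⊕ Fin (2 * n) → VField (𝓡 (2 * n + 1)) M} {V : Set M}

/-- The coefficients in the frame `f = (T, Yᵢ)` of the brackets of its members. They are indexed as
the `Θ`-frame, with the value `0` for an index `∞`. -/
def bracketCoeff (hf : IsLocalFrameOn (𝓡 (2 * n + 1)) (Model n) ∞ f V)
    (I K L : Unit ⊕ Unit ⊕ Fin (2 * n)) (p : M) : ℝ :=
  Sum.elim (fun _ => 0)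
    (fun L => hf.coeff L p (bracket (𝓡 (2 * n + 1)) (horField f I) (horField f K) p)) L

/-- The structure functions of the `Θ`-frame. The exponent in the first term is never truncated,
since `weight n L ≤ 1`. The other two terms come from the derivatives of powers of `ρ` along
`ρ∂_ρ`. -/
def thetaStructure (hf : IsLocalFrameOn (𝓡 (2 * n + 1)) (Model n) ∞ f V) (x : M × ℝ)
    (I K L : Unit ⊕ Unit ⊕ Fin (2 * n)) : ℝ :=
  x.2 ^ (weight n I + weight n K + 1 - weight n L) * bracketCoeff hf I K L x.1
    + (if K = L then rhoCoeff n I * (weight n K + 1) * x.2 ^ weight n I else 0)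
    - (if I = L then rhoCoeff n K * (weight n I + 1) * x.2 ^ weight n K else 0)

lemma smoothFieldAt_horField (hf : IsLocalFrameOn (𝓡 (2 * n + 1)) (Model n) ∞ f V) (hV : IsOpen V)
    {p : M} (hp : p ∈ V) (I : Unit ⊕ Unit ⊕ Fin (2 * n)) :
    SmoothFieldAt (𝓡 (2 * n + 1)) (horField f I) p := by
  rcases I with _ | k
  · exact (Bundle.contMDiff_zeroSection ℝ (TangentSpace (𝓡 (2 * n + 1)) : M → Type _)).contMDiffAt
  · exact hf.contMDiffAt hV hp k

lemma smoothFieldAt_bracket {X Y : VField (𝓡 (2 * n + 1)) M} {p : M}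
    (hX : SmoothFieldAt _ X p) (hY : SmoothFieldAt _ Y p) :
    SmoothFieldAt (𝓡 (2 * n + 1)) (bracket _ X Y) p :=
  haveI : IsManifold (𝓡 (2 * n + 1)) (minSmoothness ℝ 2) M := by
    rw [minSmoothness_of_isRCLikeNormedField]; infer_instance
  haveI : IsManifold (𝓡 (2 * n + 1)) (((⊤ : ℕ∞) : ℕ∞ω) + 1) M := by
    rw [show (((⊤ : ℕ∞) : ℕ∞ω) + 1) = ∞ from rfl]; infer_instance
  ContMDiffAt.mlieBracket_vectorField (n := (⊤ : ℕ∞)) (m := (⊤ : ℕ∞)) hX hY (by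
    rw [minSmoothness_of_isRCLikeNormedField]; rfl)

lemma contMDiffAt_thetaStructure (hf : IsLocalFrameOn (𝓡 (2 * n + 1)) (Model n) ∞ f V)
    (hV : IsOpen V) {x : M × ℝ} (hx : x.1 ∈ V) (I K L : Unit ⊕ Unit ⊕ Fin (2 * n)) :
    ContMDiffAt (prodModel n) 𝓘(ℝ, ℝ) ∞ (fun y => thetaStructure hf y I K L) x := by
  have hb : ContMDiffAt (prodModel n) 𝓘(ℝ, ℝ) ∞ (fun y : M × ℝ => bracketCoeff hf I K L y.1) x := by
    rcases L with _ | L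
    · exact contMDiffAt_const
    · have h1 := contMDiffAt_coeff hf hV hx (smoothFieldAt_bracket
        (smoothFieldAt_horField hf hV hx I) (smoothFieldAt_horField hf hV hx K)) L
      exact ContMDiffAt.comp (g := fun p => hf.coeff L p
        (bracket (𝓡 (2 * n + 1)) (horField f I) (horField f K) p)) x h1 contMDiffAt_fst
  have hr : ∀ k, ContMDiffAt (prodModel n) 𝓘(ℝ, ℝ) ∞ (fun y : M × ℝ => y.2 ^ k) x :=
    fun k => (contMDiff_rho_pow k).contMDiffAt
  refine ContMDiffAt.sub (((hr _).mul hb).add ?_) ?_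
  · split_ifs
    · exact contMDiffAt_const.mul (hr _)
    · exact contMDiffAt_const
  · split_ifs
    · exact contMDiffAt_const.mul (hr _)
    · exact contMDiffAt_const

/-- The brackets of the `Θ`-frame are combinations of the `Θ`-frame whose coefficients are smooth up
to `ρ = 0`: `[ρ^{v+1} X, ρ^{w+1} Y]` has the factor `ρ^{v+w+2}`, of which at most `ρ²` is used up
by a member of the frame. -/
lemma bracket_prodThetaFrame (hf : IsLocalFrameOn (𝓡 (2 * n + 1)) (Model n) ∞ f V)
    (hV : IsOpen V) {x : M × ℝ} (hx : x.1 ∈ V) (I K : Unit ⊕ Unit ⊕ Fin (2 * n)) :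
    bracket (prodModel n) (prodThetaFrame f I) (prodThetaFrame f K) x =
      ∑ L, thetaStructure hf x I K L • prodThetaFrame f L x := by
  have hb : lift (bracket _ (horField f I) (horField f K)) 0 x =
      ∑ L, bracketCoeff hf I K L x.1 • lift (horField f L) (rhoCoeff n L) x := by
    have h1 := hf.coeff_sum_eq (bracket _ (horField f I) (horField f K)) hx
    rw [Fintype.sum_sum_type, Finset.sum_eq_zero (s := (Finset.univ : Finset Unit)), zero_add]
    · let inc : Model n →ₗ[ℝ] Model n × ℝ := LinearMap.inl ℝ (Model n) ℝ
      refine (congrArg inc h1).trans ?_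
      refine (map_sum inc _ _).trans (Finset.sum_congr rfl fun L _ => ?_)
      exact map_smul inc _ _
    · intro k _
      exact zero_smul ℝ _
  rw [prodThetaFrame_eq f I, prodThetaFrame_eq f K, bracket_rho_smul_lift _ _ _ _
    (smoothFieldAt_horField hf hV hx I) (smoothFieldAt_horField hf hV hx K), hb, Finset.smul_sum]
  simp only [thetaStructure, add_smul, sub_smul, Finset.sum_add_distrib, Finset.sum_sub_distrib,
    ite_smul, zero_smul, Finset.sum_ite_eq, Finset.mem_univ, if_true]
  congr 1
  · congr 1
    · refine Finset.sum_congr rfl fun L _ => ?_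
      rw [prodThetaFrame_apply, smul_smul, smul_smul]
      congr 1
      have hL : weight n L ≤ 1 := by rcases L with _ | _ | _ <;> simp [weight]
      have : x.2 ^ (weight n I + 1) * x.2 ^ (weight n K + 1) =
          x.2 ^ (weight n I + weight n K + 1 - weight n L) * x.2 ^ (weight n L + 1) := by
        rw [← pow_add, ← pow_add]; congr 1; omega
      rw [this]; ring
    · rw [prodThetaFrame_apply, smul_smul]
      congr 1; ring
  · rw [prodThetaFrame_apply, smul_smul]
    congr 1; ring

lemma isLocalFrameOn_prodThetaFrame (hf : IsLocalFrameOn (𝓡 (2 * n + 1)) (Model n) ∞ f V)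
    (hV : IsOpen V) {Ω : Set (M × ℝ)} (hΩ : ∀ x ∈ Ω, x.1 ∈ V ∧ 0 < x.2) :
    IsLocalFrameOn (prodModel n) (Model n × ℝ) ∞ (prodThetaFrame f) Ω := by
  have hli : ∀ x ∈ Ω, LinearIndependent ℝ fun I => prodThetaFrame f I x := by
    intro x hx
    simp only [prodThetaFrame_apply]
    exact linearIndependent_smul_lift (hf.linearIndependent (hΩ x hx).1)
      fun I => pow_ne_zero _ (hΩ x hx).2.ne'
  refine ⟨fun {x} hx => hli x hx, fun {x} hx => ?_, fun I x hx => ?_⟩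
  · have hcard : Fintype.card (Unit ⊕ Unit ⊕ Fin (2 * n)) = Module.finrank ℝ (Model n × ℝ) := by
      simp; omega
    have : FiniteDimensional ℝ (TangentSpace (prodModel n) x) :=
      inferInstanceAs (FiniteDimensional ℝ (Model n × ℝ))
    exact ((hli x hx).span_eq_top_of_card_eq_finrank' hcard).ge
  · rw [prodThetaFrame_eq]
    exact (ContMDiffAt.smul_section (contMDiff_rho_pow _).contMDiffAt (smoothFieldAt_lift _
      (smoothFieldAt_horField hf hV (hΩ x hx).1 I))).contMDiffWithinAt

end ThetaFrame

/-! ### The real frame of a CR manifold -/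

section Complexified

variable {W : Type*} [AddCommGroup W] [Module ℝ W]

lemma reC_tmul (z : ℂ) (w : W) : reC W (z ⊗ₜ[ℝ] w) = z.re • w := by
  simp [reC]

lemma conjC_tmul (z : ℂ) (w : W) : conjC W (z ⊗ₜ[ℝ] w) = (starRingEnd ℂ z) ⊗ₜ[ℝ] w := by
  simp [conjC]

lemma conjC_smul (z : ℂ) (v : ℂ ⊗[ℝ] W) : conjC W (z • v) = starRingEnd ℂ z • conjC W v := by
  induction v with
  | zero => simp
  | tmul a w => simp [conjC_tmul, TensorProduct.smul_tmul']
  | add a b ha hb => simp [smul_add, ha, hb]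

lemma reC_conjC (v : ℂ ⊗[ℝ] W) : reC W (conjC W v) = reC W v := by
  induction v with
  | zero => simp
  | tmul a w => simp [conjC_tmul, reC_tmul]
  | add a b ha hb => simp [ha, hb]

end Complexified

section CRFrame

variable {n : ℕ} {M : Type*} [TopologicalSpace M] [ChartedSpace (Model n) M]

lemma reC_val (Z : CField (𝓡 (2 * n + 1)) M) (p : M) : reC _ (Z.val p) = Z.re p := by
  simp [CField.val, reC_tmul]

lemma reC_smul_val (Z : CField (𝓡 (2 * n + 1)) M) (p : M) :
    reC _ ((-Complex.I) • Z.val p) = Z.im p := by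
  simp [CField.val, TensorProduct.smul_tmul', reC_tmul]

variable [IsManifold (𝓡 (2 * n + 1)) ∞ M]
  {S : PartiallyIntegrableCR n M} {θ : ∀ p : M, TangentSpace (𝓡 (2 * n + 1)) p →ₗ[ℝ] ℝ}
  {T : VField (𝓡 (2 * n + 1)) M} {V : Set M} {Z : Fin n → CField (𝓡 (2 * n + 1)) M}

lemma IsFrameOf.val_mem (hZ : IsFrameOf S.T10 V Z) {p : M} (hp : p ∈ V) (α : Fin n) :
    (Z α).val p ∈ S.T10 p := by
  rw [← hZ.span_eq p hp]
  exact Submodule.subset_span ⟨α, rfl⟩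

lemma IsContactForm.apply_reC (hθ : IsContactForm S θ) {p : M}
    {v : ℂ ⊗[ℝ] TangentSpace (𝓡 (2 * n + 1)) p} (hv : v ∈ S.T10 p) : θ p (reC _ v) = 0 := by
  have : reC _ v ∈ LinearMap.ker (θ p) := by
    rw [hθ.ker_eq]
    exact ⟨v, hv, rfl⟩
  exact this

lemma IsContactForm.apply_part (hθ : IsContactForm S θ) (hZ : IsFrameOf S.T10 V Z) {p : M}
    (hp : p ∈ V) (α : Fin n) (b : Bool) : θ p ((Z α).part b p) = 0 := by
  cases b
  · have := hθ.apply_reC (hZ.val_mem hp α)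
    rwa [reC_val] at this
  · have := hθ.apply_reC (Submodule.smul_mem _ (-Complex.I) (hZ.val_mem hp α))
    rwa [reC_smul_val] at this

/-- The contact form vanishes on brackets of sections of `T^{1,0}`. -/
lemma IsContactForm.apply_lie (hθ : IsContactForm S θ) (hV : IsOpen V)
    (hZ : IsFrameOf S.T10 V Z) {p : M} (hp : p ∈ V) (α β : Fin n) :
    θ p (((Z α).lie (Z β)).re p) = 0 ∧ θ p (((Z α).lie (Z β)).im p) = 0 := by
  have hmem := S.bracket_mem V (Z α) (Z β) hV (hZ.smooth α) (hZ.smooth β)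
    (fun q hq => hZ.val_mem hq α) (fun q hq => hZ.val_mem hq β) p hp
  have key : ∀ v ∈ Submodule.span ℂ ((S.T10 p : Set (ℂ ⊗[ℝ] TangentSpace (𝓡 (2 * n + 1)) p)) ∪
      {v | conjC _ v ∈ S.T10 p}), ∀ z : ℂ, θ p (reC _ (z • v)) = 0 := by
    intro v hv
    induction hv using Submodule.span_induction with
    | mem v hv =>
      intro z
      rcases hv with hv | hv
      · exact hθ.apply_reC (Submodule.smul_mem _ z hv)
      · rw [← reC_conjC, conjC_smul]
        exact hθ.apply_reC (Submodule.smul_mem _ _ hv)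
    | zero => simp
    | add v w _ _ h1 h2 => intro z; rw [smul_add, map_add, map_add, h1, h2, add_zero]
    | smul a v _ h => intro z; rw [smul_smul]; exact h _
  refine ⟨?_, ?_⟩
  · have := key _ hmem 1
    rwa [one_smul, reC_val] at this
  · have := key _ hmem (-Complex.I)
    rwa [reC_smul_val] at this

/-- The real and imaginary parts of a frame of `T^{1,0}` are linearly independent over `ℝ`. -/
lemma linearIndependent_parts (hZ : IsFrameOf S.T10 V Z) {p : M} (hp : p ∈ V) :
    LinearIndependent ℝ fun k : Fin n × Bool => (Z k.1).part k.2 p := by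
  rw [Fintype.linearIndependent_iff]
  intro u hu
  -- the combination of the `Z α` with this real part is imaginary, hence it is zero
  let w : ℂ ⊗[ℝ] TangentSpace (𝓡 (2 * n + 1)) p :=
    ∑ α, ((u (α, false) : ℂ) - (u (α, true) : ℂ) * Complex.I) • (Z α).val p
  have hval : ∀ (a b : ℝ) (X : CField (𝓡 (2 * n + 1)) M),
      ((a : ℂ) - (b : ℂ) * Complex.I) • X.val p =
      (1 : ℂ) ⊗ₜ[ℝ] (a • X.re p + b • X.im p) + Complex.I ⊗ₜ[ℝ] (a • X.im p - b • X.re p) := by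
    intro a b X
    simp only [CField.val, smul_add, TensorProduct.smul_tmul', TensorProduct.tmul_add,
      TensorProduct.tmul_sub, ← TensorProduct.smul_tmul, smul_eq_mul, mul_one]
    have h1 : ((a : ℂ) - b * Complex.I) = a • (1 : ℂ) - b • Complex.I := by simp
    have h2 : ((a : ℂ) - b * Complex.I) * Complex.I = b • (1 : ℂ) + a • Complex.I := by
      rw [sub_mul, mul_assoc, Complex.I_mul_I]; simp; ring
    rw [h2, h1, TensorProduct.sub_tmul, TensorProduct.add_tmul]
    abel
  have hw : w = Complex.I ⊗ₜ[ℝ] (∑ α, (u (α, false) • (Z α).im p - u (α, true) • (Z α).re p)) := by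
    simp only [w, hval, Finset.sum_add_distrib, ← TensorProduct.tmul_sum]
    have : ∑ α, (u (α, false) • (Z α).re p + u (α, true) • (Z α).im p) = 0 := by
      rw [← hu, Fintype.sum_prod_type]
      refine Finset.sum_congr rfl fun α _ => ?_
      exact (add_comm _ _).trans
        (Fintype.sum_bool fun b => u (α, b) • (Z α).part b p).symm
    rw [← Finset.sum_add_distrib, this, TensorProduct.tmul_zero, zero_add]
  have hwT : w ∈ S.T10 p :=
    Submodule.sum_mem _ fun α _ => Submodule.smul_mem _ _ (hZ.val_mem hp α)
  have hcw : conjC _ w = -w := by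
    rw [hw, conjC_tmul, Complex.conj_I, TensorProduct.neg_tmul]
  have hw0 : w = 0 := S.conj_inter p w hwT (hcw ▸ Submodule.neg_mem _ hwT)
  have hcoef := Fintype.linearIndependent_iff.1 (hZ.linearIndependent p hp) _ hw0
  rintro ⟨α, b⟩
  have h := hcoef α
  cases b
  · simpa using congrArg Complex.re h
  · simpa using congrArg Complex.im h

/-- An enumeration of the real and imaginary parts of `n` complex fields. -/
def partIndex (n : ℕ) : Fin n × Bool ≃ Fin (2 * n) :=
  Fintype.equivFinOfCardEq (by simp [mul_comm])

/-- The real frame `T, Re Z_α, Im Z_α`. -/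
def crFrame (T : VField (𝓡 (2 * n + 1)) M) (Z : Fin n → CField (𝓡 (2 * n + 1)) M) :
    Unit ⊕ Fin (2 * n) → VField (𝓡 (2 * n + 1)) M :=
  Sum.elim (fun _ => T)
    (fun i => (Z ((partIndex n).symm i).1).part ((partIndex n).symm i).2)

lemma isLocalFrameOn_crFrame (hθ : IsContactForm S θ) (hT : IsReebField θ T)
    (hZ : IsFrameOf S.T10 V Z) :
    IsLocalFrameOn (𝓡 (2 * n + 1)) (Model n) ∞ (crFrame T Z) V := by
  have hli : ∀ p ∈ V, LinearIndependent ℝ fun k => crFrame T Z k p := by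
    intro p hp
    have h1 : LinearIndependent ℝ fun i => crFrame T Z (Sum.inr i) p :=
      (linearIndependent_parts hZ hp).comp _ (partIndex n).symm.injective
    rw [Fintype.linearIndependent_iff] at h1 ⊢
    intro u hu
    rw [Fintype.sum_sum_type] at hu
    have h2 := congrArg (θ p) hu
    rw [map_add, map_sum, map_sum, Finset.sum_eq_zero (s := (Finset.univ : Finset (Fin (2 * n))))
      fun i _ => ?_] at h2
    · have h3 : u (Sum.inl ()) = 0 := by
        simpa [crFrame, hT.apply_eq_one] using h2
      rintro (⟨⟩ | i)
      · exact h3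
      · refine h1 (fun i => u (Sum.inr i)) ?_ i
        simpa [h3] using hu
    · rw [map_smul]
      exact (congrArg _ (hθ.apply_part hZ hp _ _)).trans (smul_zero _)
  refine ⟨fun {p} hp => hli p hp, fun {p} hp => ?_, fun k => ?_⟩
  · have hcard : Fintype.card (Unit ⊕ Fin (2 * n)) = Module.finrank ℝ (Model n) := by
      simp; omega
    have : FiniteDimensional ℝ (TangentSpace (𝓡 (2 * n + 1)) p) :=
      inferInstanceAs (FiniteDimensional ℝ (Model n))
    exact ((hli p hp).span_eq_top_of_card_eq_finrank' hcard).ge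
  · rcases k with _ | i
    · exact hT.smooth.mono (Set.subset_univ V)
    · change SmoothFieldOn _ ((Z ((partIndex n).symm i).1).part ((partIndex n).symm i).2) V
      cases ((partIndex n).symm i).2
      · exact (hZ.smooth _).1
      · exact (hZ.smooth _).2

/-- The value of the contact form on brackets of the real frame of `H`. -/
def thetaBracket (θ : ∀ p : M, TangentSpace (𝓡 (2 * n + 1)) p →ₗ[ℝ] ℝ)
    (Z : Fin n → CField (𝓡 (2 * n + 1)) M) (p : M) (α : Fin n) (a : Bool) (β : Fin n) (b : Bool) :
    ℝ := θ p (bracket _ ((Z α).part a) ((Z β).part b) p)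

/-- The `T`-coefficient of a vector is given by the contact form. -/
lemma coeff_crFrame_reeb (hθ : IsContactForm S θ) (hT : IsReebField θ T)
    (hZ : IsFrameOf S.T10 V Z) {p : M} (hp : p ∈ V) (X : VField (𝓡 (2 * n + 1)) M) :
    (isLocalFrameOn_crFrame hθ hT hZ).coeff (Sum.inl ()) p (X p) = θ p (X p) := by
  set hf := isLocalFrameOn_crFrame hθ hT hZ
  have h := congrArg (θ p) (hf.coeff_sum_eq X hp)
  rw [Fintype.sum_sum_type, map_add, map_sum, map_sum,
    Finset.sum_eq_zero (s := (Finset.univ : Finset (Fin (2 * n)))) fun i _ => ?_] at h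
  · rw [h, Finset.univ_unique, Finset.sum_singleton, add_zero, map_smul]
    exact ((mul_one _).symm.trans (congrArg _ (hT.apply_eq_one p).symm))
  · rw [map_smul]
    exact (congrArg _ (hθ.apply_part hZ hp _ _)).trans (smul_zero _)

lemma smoothFieldAt_part (hV : IsOpen V) (hZ : IsFrameOf S.T10 V Z) {p : M} (hp : p ∈ V)
    (α : Fin n) (b : Bool) : SmoothFieldAt (𝓡 (2 * n + 1)) ((Z α).part b) p := by
  cases b
  · exact (hZ.smooth α).1.contMDiffAt (hV.mem_nhds hp)
  · exact (hZ.smooth α).2.contMDiffAt (hV.mem_nhds hp)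

/-- The brackets of the real frame in the direction of `T`, in terms of the Levi form. -/
lemma thetaBracket_conj (hθ : IsContactForm S θ) (hV : IsOpen V) (hZ : IsFrameOf S.T10 V Z)
    {p : M} (hp : p ∈ V) (α β : Fin n) :
    (thetaBracket θ Z p α false β false + thetaBracket θ Z p α true β true : ℂ)
      + Complex.I * (thetaBracket θ Z p α true β false - thetaBracket θ Z p α false β true) =
    -Complex.I * leviForm θ Z α β p := by
  have hzero : ∀ (α : Fin n) (b : Bool), (fun q => θ q ((Z α).part b q)) =ᶠ[𝓝 p] fun _ => 0 := by
    intro α b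
    filter_upwards [hV.mem_nhds hp] with q hq
    exact hθ.apply_part hZ hq α b
  have hd : ∀ (X : VField (𝓡 (2 * n + 1)) M) {h : M → ℝ}, h =ᶠ[𝓝 p] (fun _ => 0) →
      deriv _ X h p = 0 := fun X h hh => (deriv_congr rfl hh).trans (deriv_const X 0 p)
  have hext : ∀ a b, extDeriv θ ((Z α).part a) ((Z β).part b) p = -thetaBracket θ Z p α a β b := by
    intro a b
    rw [extDeriv, hd _ (hzero β b), hd _ (hzero α a), thetaBracket]
    ring
  have hneg : ∀ a, extDeriv θ ((Z α).part a) ((Z β).conj.part true) p =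
      thetaBracket θ Z p α a β true := by
    intro a
    have h1 : (fun q => θ q ((Z β).conj.part true q)) =ᶠ[𝓝 p] fun _ => 0 := by
      filter_upwards [hzero β true] with q hq
      refine Eq.trans (map_neg (θ q) ((Z β).im q)) ?_
      exact neg_eq_zero.2 hq
    have h2 : bracket _ ((Z α).part a) ((Z β).conj.part true) p =
        -bracket _ ((Z α).part a) ((Z β).part true) p := by
      have h3 := VectorField.mlieBracket_const_smul_right (I := 𝓡 (2 * n + 1))
        (V := (Z α).part a) (c := (-1 : ℝ))
        ((smoothFieldAt_part hV hZ hp β true).mdifferentiableAt (by simp))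
      refine Eq.trans ?_ (h3.trans (neg_one_smul ℝ _))
      congr 1
      funext q
      exact (neg_one_smul ℝ _).symm
    rw [extDeriv, hd _ h1, hd _ (hzero α a), h2, map_neg, thetaBracket]
    ring
  have hpos : ∀ a, extDeriv θ ((Z α).part a) ((Z β).conj.part false) p =
      -thetaBracket θ Z p α a β false := fun a => hext a false
  simp only [leviForm, cExt₂, Fintype.sum_bool, hneg, hpos, unitOf, if_true, if_false,
    Bool.false_eq_true]
  push_cast
  linear_combination (thetaBracket θ Z p α true β true
    - Complex.I ^ 2 * (thetaBracket θ Z p α true β true : ℂ)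
    - Complex.I * (thetaBracket θ Z p α false β true - thetaBracket θ Z p α true β false : ℂ)
    + thetaBracket θ Z p α false β false) * Complex.I_sq

/-- Partial integrability, in terms of the real frame. -/
lemma thetaBracket_same (hθ : IsContactForm S θ) (hV : IsOpen V) (hZ : IsFrameOf S.T10 V Z)
    {p : M} (hp : p ∈ V) (α β : Fin n) :
    thetaBracket θ Z p α false β false = thetaBracket θ Z p α true β true ∧
      thetaBracket θ Z p α false β true = -thetaBracket θ Z p α true β false := by
  obtain ⟨h1, h2⟩ := hθ.apply_lie hV hZ hp α β
  change θ p (bracket _ (Z α).re (Z β).re p - bracket _ (Z α).im (Z β).im p) = 0 at h1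
  change θ p (bracket _ (Z α).re (Z β).im p + bracket _ (Z α).im (Z β).re p) = 0 at h2
  rw [map_sub, sub_eq_zero] at h1
  rw [map_add] at h2
  exact ⟨h1, eq_neg_of_add_eq_zero_left h2⟩

end CRFrame

/-! ### Complexification of coefficient arrays -/

section Complexification

variable {ι : Type*} [Fintype ι]

/-- The complex vector with real part `a false` and imaginary part `a true`. -/
def cvec (a : Bool → ι → ℝ) : ι → ℂ :=
  (fun I => (a false I : ℂ)) + Complex.I • (fun I => (a true I : ℂ))

/-- The algebraic expression for the curvature of a metric with constant coefficients in a frame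
with constant structure functions. -/
def algCurv {R : Type*} [CommRing R] (G : ι → ι → R) (c Γ : ι → ι → ι → R) (a b u w : ι → R) : R :=
  bil G (tri Γ a (tri Γ b u) - tri Γ b (tri Γ a u) - tri Γ (tri c a b) u) w

/-- The multilinear extension, written as a sum over real and imaginary parts, is the form with the
same matrix over `ℂ`. -/
lemma sum_unitOf_bil (G : ι → ι → ℝ) (a b : Bool → ι → ℝ) :
    ∑ i : Bool, ∑ j : Bool, unitOf i * unitOf j * (bil G (a i) (b j) : ℂ) =
      bil (fun I K => (G I K : ℂ)) (cvec a) (cvec b) := by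
  simp only [cvec, map_add, map_smul, LinearMap.add_apply, LinearMap.smul_apply, bil_ofReal,
    Fintype.sum_bool, unitOf, if_true, if_false, Bool.false_eq_true, smul_eq_mul]
  ring

lemma algCurv_ofReal (G : ι → ι → ℝ) (c Γ : ι → ι → ι → ℝ) (a b u w : ι → ℝ) :
    ((algCurv G c Γ a b u w : ℝ) : ℂ) = algCurv (fun I K => (G I K : ℂ))
      (fun I K L => (c I K L : ℂ)) (fun I K L => (Γ I K L : ℂ)) (fun I => (a I : ℂ))
      (fun I => (b I : ℂ)) (fun I => (u I : ℂ)) (fun I => (w I : ℂ)) := by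
  simp only [algCurv, map_sub, LinearMap.sub_apply, tri_ofReal, bil_ofReal]
  push_cast
  rfl

lemma sum_unitOf_algCurv (G : ι → ι → ℝ) (c Γ : ι → ι → ι → ℝ) (a b u w : Bool → ι → ℝ) :
    ∑ i : Bool, ∑ j : Bool, ∑ k : Bool, ∑ l : Bool,
      unitOf i * unitOf j * unitOf k * unitOf l *
        ((algCurv G c Γ (a i) (b j) (u k) (w l) : ℝ) : ℂ) =
      algCurv (fun I K => (G I K : ℂ)) (fun I K L => (c I K L : ℂ)) (fun I K L => (Γ I K L : ℂ))
        (cvec a) (cvec b) (cvec u) (cvec w) := by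
  simp only [algCurv_ofReal]
  simp only [algCurv, cvec, map_add, map_sub, map_smul, LinearMap.add_apply, LinearMap.sub_apply,
    LinearMap.smul_apply, Fintype.sum_bool, unitOf, if_true, if_false, Bool.false_eq_true,
    smul_eq_mul]
  ring

lemma bil_conj (G : ι → ι → ℝ) (u v : ι → ℂ) :
    bil (fun I K => (G I K : ℂ)) (fun I => starRingEnd ℂ (u I)) (fun I => starRingEnd ℂ (v I)) =
      starRingEnd ℂ (bil (fun I K => (G I K : ℂ)) u v) := by
  simp [bil_apply, map_sum]

end Complexification

/-! ### Extension of the Christoffel symbols to the boundary -/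

section Extension

variable {E : Type*} [NormedAddCommGroup E] [NormedSpace ℝ E]
  {H : Type*} [TopologicalSpace H] {J : ModelWithCorners ℝ E H}
  {N : Type*} [TopologicalSpace N] [ChartedSpace H N]
  {ι : Type*} [Fintype ι]

/-- The derivative of `f` along `X`, where `f` is considered as a function on the set `S`. -/
def derivWithin (S : Set N) (X : VField J N) (f : N → ℝ) (x : N) : ℝ :=
  mfderivWithin J 𝓘(ℝ, ℝ) f S x (X x)

lemma derivWithin_eq_zero {S : Set N} {X : VField J N} {x : N} (hX : X x = 0) (f : N → ℝ) :
    derivWithin S X f x = 0 := by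
  rw [derivWithin, hX, map_zero]; rfl

lemma derivWithin_eq_deriv {S : Set N} {x : N} (hS : S ∈ 𝓝 x) (X : VField J N) (f : N → ℝ) :
    derivWithin S X f x = deriv J X f x := by
  rw [derivWithin, mfderivWithin_of_mem_nhds hS]; rfl

/-- The Koszul expression for the members of the frame `e`, for a metric with matrix `G` and for
structure functions `c`, with derivatives within `S`. -/
def koszulArray (S : Set N) (e : ι → VField J N) (G : N → ι → ι → ℝ) (c : N → ι → ι → ι → ℝ)
    (x : N) (I K L : ι) : ℝ :=
  derivWithin S (e I) (fun y => G y K L) x + derivWithin S (e K) (fun y => G y I L) x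
    - derivWithin S (e L) (fun y => G y I K) x + ∑ M, c x I K M * G x M L
    - ∑ M, c x I L M * G x M K - ∑ M, c x K L M * G x M I

/-- The Christoffel symbols, with derivatives within `S`. They are obtained from the Koszul
expression with the inverse matrix of the metric. -/
def christoffel [DecidableEq ι] (S : Set N) (e : ι → VField J N) (G : N → ι → ι → ℝ)
    (c : N → ι → ι → ι → ℝ) (x : N) (I K M : ι) : ℝ :=
  (1 / 2) * ∑ L, koszulArray S e G c x I K L * (Matrix.of (G x))⁻¹ L M

/-- The curvature tensor on vector fields with constant coefficients, with derivatives within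
`S`. -/
def curvArray [DecidableEq ι] (S : Set N) (e : ι → VField J N) (G : N → ι → ι → ℝ)
    (c : N → ι → ι → ι → ℝ) (a b u w : ι → ℝ) (x : N) : ℝ :=
  algCurv (G x) (c x) (christoffel S e G c x) a b u w
    + bil (G x) (fun L => derivWithin S (combo e fun _ => a)
      (fun y => tri (christoffel S e G c y) b u L) x) w
    - bil (G x) (fun L => derivWithin S (combo e fun _ => b)
      (fun y => tri (christoffel S e G c y) a u L) x) w

variable {S : Set N} {e : ι → VField J N} {G : N → ι → ι → ℝ} {c : N → ι → ι → ι → ℝ}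

section

variable [DecidableEq ι]

lemma two_mul_sum_christoffel {x : N} (hdet : (Matrix.of (G x)).det ≠ 0) (I K L : ι) :
    2 * ∑ M, christoffel S e G c x I K M * G x M L = koszulArray S e G c x I K L := by
  have h := congrFun (congrArg (Matrix.vecMul (fun L => koszulArray S e G c x I K L))
    (Matrix.nonsing_inv_mul _ (isUnit_iff_ne_zero.2 hdet))) L
  rw [← Matrix.vecMul_vecMul, Matrix.vecMul_one] at h
  rw [← h]
  simp only [christoffel, Matrix.vecMul, dotProduct, Matrix.of_apply]
  rw [Finset.mul_sum]
  exact Finset.sum_congr rfl fun M _ => by ring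

/-- Where the frame vanishes, the curvature is given by its algebraic part. -/
lemma curvArray_eq_algCurv {x : N} (hx : ∀ I, e I x = 0) (a b u w : ι → ℝ) :
    curvArray S e G c a b u w x =
      algCurv (G x) (c x) (christoffel S e G c x) a b u w := by
  have h0 : ∀ a : ι → ℝ, combo e (fun _ => a) x = 0 := fun a => by simp [combo, hx]
  have h1 : ∀ (a : ι → ℝ) (F : N → ι → ℝ),
      (fun L => derivWithin S (combo e fun _ => a) (fun y => F y L) x) = 0 := fun a F =>
    funext fun L => derivWithin_eq_zero (h0 a) _
  rw [curvArray, h1 a fun y => tri (christoffel S e G c y) b u,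
    h1 b fun y => tri (christoffel S e G c y) a u]
  simp

/-- Where the frame vanishes, the Koszul formula is algebraic. -/
lemma koszul_christoffel {x : N} (hx : ∀ I, e I x = 0) (hdet : (Matrix.of (G x)).det ≠ 0)
    (u w z : ι → ℂ) :
    2 * bil (fun I K => (G x I K : ℂ))
        (tri (fun I K L => (christoffel S e G c x I K L : ℂ)) u w) z =
      bil (fun I K => (G x I K : ℂ)) (tri (fun I K L => (c x I K L : ℂ)) u w) z
      - bil (fun I K => (G x I K : ℂ)) (tri (fun I K L => (c x I K L : ℂ)) u z) w
      - bil (fun I K => (G x I K : ℂ)) (tri (fun I K L => (c x I K L : ℂ)) w z) u := by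
  have hr : ∀ (A : ι → ι → ι → ℝ) (I K L : ι),
      bil (fun I K => (G x I K : ℂ)) (fun M => (A I K M : ℂ)) (Pi.single L 1) =
        ((∑ M, A I K M * G x M L : ℝ) : ℂ) := by
    intro A I K L
    push_cast
    exact bil_single_right _ _ L
  set GC : ι → ι → ℂ := fun I K => (G x I K : ℂ)
  set cC : ι → ι → ι → ℂ := fun I K L => (c x I K L : ℂ)
  set ΓC : ι → ι → ι → ℂ := fun I K L => (christoffel S e G c x I K L : ℂ)
  refine eq_of_isLinearMap
    (f := fun u => 2 * bil GC (tri ΓC u w) z)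
    (f' := fun u => bil GC (tri cC u w) z - bil GC (tri cC u z) w
      - bil GC (tri cC w z) u) ?_ ?_ (fun I => ?_) _
  · constructor <;> intros <;> simp <;> ring
  · constructor <;> intros <;> simp <;> ring
  refine eq_of_isLinearMap
    (f := fun w => 2 * bil GC (tri ΓC (Pi.single I 1) w) z)
    (f' := fun w => bil GC (tri cC (Pi.single I 1) w) z - bil GC (tri cC (Pi.single I 1) z) w
      - bil GC (tri cC w z) (Pi.single I 1)) ?_ ?_ (fun K => ?_) _
  · constructor <;> intros <;> simp <;> ring
  · constructor <;> intros <;> simp <;> ring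
  refine eq_of_isLinearMap
    (f := fun z => 2 * bil GC (tri ΓC (Pi.single I 1) (Pi.single K 1)) z)
    (f' := fun z => bil GC (tri cC (Pi.single I 1) (Pi.single K 1)) z
      - bil GC (tri cC (Pi.single I 1) z) (Pi.single K 1)
      - bil GC (tri cC (Pi.single K 1) z) (Pi.single I 1)) ?_ ?_ (fun L => ?_) _
  · constructor <;> intros <;> simp <;> ring
  · constructor <;> intros <;> simp <;> ring
  rw [tri_single, tri_single, tri_single, tri_single, hr (christoffel S e G c x), hr (c x),
    hr (c x), hr (c x)]
  have h1 := two_mul_sum_christoffel (S := S) (e := e) (c := c) hdet I K L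
  simp only [koszulArray, derivWithin_eq_zero (hx _)] at h1
  norm_cast
  rw [h1]
  ring

end

lemma contMDiffOn_bil {a b : N → ι → ℝ} (hG : ∀ I K, ContMDiffOn J 𝓘(ℝ, ℝ) ∞ (fun y => G y I K) S)
    (ha : ∀ I, ContMDiffOn J 𝓘(ℝ, ℝ) ∞ (fun y => a y I) S)
    (hb : ∀ I, ContMDiffOn J 𝓘(ℝ, ℝ) ∞ (fun y => b y I) S) :
    ContMDiffOn J 𝓘(ℝ, ℝ) ∞ (fun y => bil (G y) (a y) (b y)) S := by
  simp only [bil_apply]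
  exact fun x hx => contMDiffWithinAt_finsetSum fun I _ => contMDiffWithinAt_finsetSum fun K _ =>
    ((ha I x hx).mul (hb K x hx)).mul (hG I K x hx)

lemma contMDiffOn_tri {A : N → ι → ι → ι → ℝ} {a b : N → ι → ℝ}
    (hA : ∀ I K L, ContMDiffOn J 𝓘(ℝ, ℝ) ∞ (fun y => A y I K L) S)
    (ha : ∀ I, ContMDiffOn J 𝓘(ℝ, ℝ) ∞ (fun y => a y I) S)
    (hb : ∀ I, ContMDiffOn J 𝓘(ℝ, ℝ) ∞ (fun y => b y I) S) (L : ι) :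
    ContMDiffOn J 𝓘(ℝ, ℝ) ∞ (fun y => tri (A y) (a y) (b y) L) S :=
  contMDiffOn_bil (fun I K => hA I K L) ha hb

variable [IsManifold J ∞ N]

/-- The derivative of a function along a vector field is smooth up to the boundary. -/
lemma contMDiffOn_derivWithin (hS : UniqueMDiffOn J S) {f : N → ℝ}
    (hf : ContMDiffOn J 𝓘(ℝ, ℝ) ∞ f S) {X : VField J N}
    (hX : ∀ x ∈ S, SmoothFieldAt J X x) :
    ContMDiffOn J 𝓘(ℝ, ℝ) ∞ (derivWithin S X f) S := by
  have h1 : ContMDiffOn J.tangent 𝓘(ℝ, ℝ).tangent ∞ (tangentMapWithin J 𝓘(ℝ, ℝ) f S)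
      (Bundle.TotalSpace.proj ⁻¹' S) :=
    hf.contMDiffOn_tangentMapWithin (by rfl) hS
  have h2 : ContMDiffOn J J.tangent ∞ (fun x => (⟨x, X x⟩ : TangentBundle J N)) S :=
    fun x hx => (hX x hx).contMDiffWithinAt
  exact (contMDiff_snd_tangentBundle_modelSpace ℝ 𝓘(ℝ, ℝ)).comp_contMDiffOn
    (h1.comp h2 fun x hx => hx)

lemma smoothFieldAt_combo {x : N} (he : ∀ I, SmoothFieldAt J (e I) x) (a : ι → ℝ) :
    SmoothFieldAt J (combo e fun _ => a) x :=
  ContMDiffAt.sum_section fun I _ => ContMDiffAt.smul_section contMDiffAt_const (he I)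

variable [DecidableEq ι]

lemma contMDiffOn_christoffel (hS : UniqueMDiffOn J S) (he : ∀ I, ∀ x ∈ S, SmoothFieldAt J (e I) x)
    (hG : ∀ I K, ContMDiffOn J 𝓘(ℝ, ℝ) ∞ (fun y => G y I K) S)
    (hdet : ∀ x ∈ S, (Matrix.of (G x)).det ≠ 0)
    (hc : ∀ I K L, ContMDiffOn J 𝓘(ℝ, ℝ) ∞ (fun y => c y I K L) S) (I K M : ι) :
    ContMDiffOn J 𝓘(ℝ, ℝ) ∞ (fun y => christoffel S e G c y I K M) S := by
  have hsum : ∀ I K L, ContMDiffOn J 𝓘(ℝ, ℝ) ∞ (fun y => ∑ M, c y I K M * G y M L) S :=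
    fun I K L x hx => contMDiffWithinAt_finsetSum fun M _ => (hc I K M x hx).mul (hG M L x hx)
  have hk : ∀ L, ContMDiffOn J 𝓘(ℝ, ℝ) ∞ (fun y => koszulArray S e G c y I K L) S := fun L =>
    ((((contMDiffOn_derivWithin hS (hG K L) (he I)).add
      (contMDiffOn_derivWithin hS (hG I L) (he K))).sub
      (contMDiffOn_derivWithin hS (hG I K) (he L))).add (hsum I K L)).sub (hsum I L K)
      |>.sub (hsum K L I)
  intro x hx
  exact contMDiffWithinAt_const.mul (contMDiffWithinAt_finsetSum fun L _ => (hk L x hx).mul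
    (contMDiffWithinAt_matrix_inv (fun a b => hG a b x hx) (hdet x hx) L M))

lemma contMDiffOn_curvArray (hS : UniqueMDiffOn J S) (he : ∀ I, ∀ x ∈ S, SmoothFieldAt J (e I) x)
    (hG : ∀ I K, ContMDiffOn J 𝓘(ℝ, ℝ) ∞ (fun y => G y I K) S)
    (hdet : ∀ x ∈ S, (Matrix.of (G x)).det ≠ 0)
    (hc : ∀ I K L, ContMDiffOn J 𝓘(ℝ, ℝ) ∞ (fun y => c y I K L) S) (a b u w : ι → ℝ) :
    ContMDiffOn J 𝓘(ℝ, ℝ) ∞ (curvArray S e G c a b u w) S := by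
  have hΓ := contMDiffOn_christoffel hS he hG hdet hc
  have hk : ∀ (p : ι → ℝ) (I : ι), ContMDiffOn J 𝓘(ℝ, ℝ) ∞ (fun _ : N => p I) S := fun p I =>
    contMDiffOn_const
  have hcombo := fun (p : ι → ℝ) x hx => smoothFieldAt_combo (fun I => he I x hx) p
  have hD : ∀ p q r : ι → ℝ, ContMDiffOn J 𝓘(ℝ, ℝ) ∞ (fun x => bil (G x)
      (fun L => derivWithin S (combo e fun _ => p)
        (fun y => tri (christoffel S e G c y) q r L) x) w) S := fun p q r =>
    contMDiffOn_bil hG (fun L => contMDiffOn_derivWithin hS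
      (contMDiffOn_tri hΓ (hk q) (hk r) L) (hcombo p)) (hk w)
  refine (ContMDiffOn.add ?_ (hD a b u)).sub (hD b a u)
  refine contMDiffOn_bil hG (fun L => ContMDiffOn.sub (ContMDiffOn.sub ?_ ?_) ?_) (hk w)
  · exact contMDiffOn_tri hΓ (hk a) (contMDiffOn_tri hΓ (hk b) (hk u)) L
  · exact contMDiffOn_tri hΓ (hk b) (contMDiffOn_tri hΓ (hk a) (hk u)) L
  · exact contMDiffOn_tri hΓ (contMDiffOn_tri hc (hk a) (hk b)) (hk u) L

variable {g : ∀ x : N, LinearMap.BilinForm ℝ (TangentSpace J x)} {Ω : Set N}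

/-- Over the open set `Ω`, the Christoffel symbols computed within `S ⊇ Ω` are those of `g`. -/
lemma isMetricFrame_christoffel (hΩ : IsOpen Ω) (hΩS : Ω ⊆ S) (hframe : IsLocalFrameOn J E ∞ e Ω)
    (hbr : ∀ x ∈ Ω, ∀ I K, bracket J (e I) (e K) x = ∑ L, c x I K L • e L x)
    (hsymm : ∀ x ∈ Ω, ∀ v w, g x v w = g x w v)
    (hG : ∀ I K, ContMDiffOn J 𝓘(ℝ, ℝ) ∞ (fun y => G y I K) S)
    (hdet : ∀ x ∈ S, (Matrix.of (G x)).det ≠ 0) (hgram : ∀ x ∈ Ω, gram g e x = G x) :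
    IsMetricFrame g e Ω c (christoffel S e G c) where
  isOpen := hΩ
  frame := hframe
  bracket_eq := hbr
  symm := hsymm
  smooth_gram I K := ((hG I K).mono hΩS).congr fun x hx => by rw [hgram x hx]
  det_ne_zero x hx inst := by
    rw [hgram x hx]
    convert hdet x (hΩS hx)
  christoffel x hx I K L := by
    have hnhds : S ∈ 𝓝 x := Filter.mem_of_superset (hΩ.mem_nhds hx) hΩS
    have hd : ∀ A I K, derivWithin S (e A) (fun y => G y I K) x =
        deriv J (e A) (inner g (e I) (e K)) x := by
      intro A I K
      rw [derivWithin_eq_deriv hnhds]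
      refine deriv_congr rfl ?_
      filter_upwards [hΩ.mem_nhds hx] with y hy
      rw [← hgram y hy]; rfl
    have hb : ∀ I K L, inner g (bracket J (e I) (e K)) (e L) x = ∑ M, c x I K M * G x M L := by
      intro I K L
      rw [← hgram x hx]
      simp only [inner, hbr x hx, map_sum, map_smul, LinearMap.sum_apply, LinearMap.smul_apply,
        smul_eq_mul, gram]
    rw [hgram x hx, two_mul_sum_christoffel (hdet x (hΩS hx)), koszulArray, koszul, hd, hd, hd,
      hb, hb, hb]

variable [CompleteSpace E] [FiniteDimensional ℝ E]

/-- Over the open set `Ω`, the array computed within `S ⊇ Ω` is the curvature tensor of `g`. -/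
lemma riemann_eq_curvArray (h : IsMetricFrame g e Ω c (christoffel S e G c)) (hΩS : Ω ⊆ S)
    (hS : UniqueMDiffOn J S) (he : ∀ I, ∀ x ∈ S, SmoothFieldAt J (e I) x)
    (hG : ∀ I K, ContMDiffOn J 𝓘(ℝ, ℝ) ∞ (fun y => G y I K) S)
    (hdet : ∀ x ∈ S, (Matrix.of (G x)).det ≠ 0)
    (hc : ∀ I K L, ContMDiffOn J 𝓘(ℝ, ℝ) ∞ (fun y => c y I K L) S)
    (hgram : ∀ x ∈ Ω, gram g e x = G x) {x : N} (hx : x ∈ Ω) (a b u w : ι → ℝ) :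
    riemann g (combo e fun _ => a) (combo e fun _ => b) (combo e fun _ => u)
      (combo e fun _ => w) x = curvArray S e G c a b u w x := by
  have hnhds : S ∈ 𝓝 x := Filter.mem_of_superset (h.isOpen.mem_nhds hx) hΩS
  have hd : ∀ p q r : ι → ℝ, (fun L => derivWithin S (combo e fun _ => p)
      (fun y => tri (christoffel S e G c y) q r L) x) =
      dvec (combo e fun _ => p) (fun y => tri (christoffel S e G c y) q r) x := fun p q r =>
    funext fun L => derivWithin_eq_deriv hnhds _ _
  rw [h.riemann_eq (fun I K L => (hc I K L).mono hΩS)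
    (fun I K L => (contMDiffOn_christoffel hS he hG hdet hc I K L).mono hΩS) hx, curvArray,
    hd, hd, hgram x hx, algCurv]
  simp only [map_add, map_sub, LinearMap.add_apply, LinearMap.sub_apply]
  ring

end Extension

/-! ### The frame `Z_P` at the boundary -/

section Boundary

variable {n : ℕ} {M : Type*} [TopologicalSpace M] [ChartedSpace (Model n) M]

/-- The coefficients of the real part (`false`) and the imaginary part (`true`) of `Z_P` in the
frame `ρ∂_ρ, ρ²T, ρ Re Z_α, ρ Im Z_α`. -/
def zCoeff : Option (Fin n) × Bool → Bool → Unit ⊕ Unit ⊕ Fin (2 * n) → ℝ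
  | (none, _), false => (1 / 2 : ℝ) • Pi.single (Sum.inl ()) 1
  | (none, s), true => (if s then -1 else 1 : ℝ) • Pi.single (Sum.inr (Sum.inl ())) 1
  | (some α, _), false => (1 : ℝ) • Pi.single (Sum.inr (Sum.inr (partIndex n (α, false)))) 1
  | (some α, s), true =>
    (if s then -1 else 1 : ℝ) • Pi.single (Sum.inr (Sum.inr (partIndex n (α, true)))) 1

/-- The coefficients of `Z_∞`. -/
def inftyCoeff (n : ℕ) (b : Bool) : Unit ⊕ Unit ⊕ Fin (2 * n) → ℝ :=
  (if b then 0 else 1 : ℝ) • Pi.single (Sum.inl ()) 1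

/-- The coefficients of `Z_0`. -/
def zeroCoeff (n : ℕ) (b : Bool) : Unit ⊕ Unit ⊕ Fin (2 * n) → ℝ :=
  (if b then 0 else 1 : ℝ) • Pi.single (Sum.inr (Sum.inl ())) 1

lemma combo_smul_single {ι : Type*} [Fintype ι] [DecidableEq ι]
    (e : ι → VField (prodModel n) (M × ℝ)) (r : ℝ) (I : ι) (x : M × ℝ) :
    combo e (fun _ => r • Pi.single I 1) x = r • e I x := by
  rw [combo, Finset.sum_eq_single I]
  · simp
  · intro K _ hK; simp [hK]
  · simp

lemma mkVec_smul (x : M × ℝ) (r s : ℝ) (u : TangentSpace (𝓡 (2 * n + 1)) x.1) :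
    r • mkVec x u s = mkVec x (r • u) (r * s) := rfl

variable {T : VField (𝓡 (2 * n + 1)) M} {Z : Fin n → CField (𝓡 (2 * n + 1)) M}

lemma part_zInfty (b : Bool) :
    (zInfty : CField (prodModel n) (M × ℝ)).part b =
      combo (prodThetaFrame (crFrame T Z)) fun _ => inftyCoeff n b := by
  funext x
  rw [inftyCoeff, combo_smul_single]
  cases b
  · simp [CField.part, zInfty, prodThetaFrame, thetaFrame, lift, mkVec_smul]
  · simp [CField.part, zInfty]

lemma part_zZero (b : Bool) :
    (zZero T).part b = combo (prodThetaFrame (crFrame T Z)) fun _ => zeroCoeff n b := by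
  funext x
  rw [zeroCoeff, combo_smul_single]
  cases b
  · simp [CField.part, zZero, prodThetaFrame, thetaFrame, lift, mkVec_smul, crFrame]
  · simp [CField.part, zZero]

lemma part_zFrame (P : Option (Fin n) × Bool) (b : Bool) :
    (zFrame T Z P).part b = combo (prodThetaFrame (crFrame T Z)) fun _ => zCoeff P b := by
  funext x
  obtain ⟨_ | α, _ | _⟩ := P <;> cases b <;>
    simp only [zCoeff, combo_smul_single, if_true, if_false, Bool.false_eq_true]
  · simp [zFrame, CField.part, zTau, zInfty, prodThetaFrame, thetaFrame, lift, mkVec_smul]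
  · simp [zFrame, CField.part, zTau, zZero, prodThetaFrame, thetaFrame, lift, mkVec_smul, crFrame]
  · simp [zFrame, CField.part, CField.conj, zTau, zInfty, prodThetaFrame, thetaFrame, lift,
      mkVec_smul]
  · simp [zFrame, CField.part, CField.conj, zTau, zZero, prodThetaFrame, thetaFrame, lift,
      mkVec_smul, crFrame]
  · simp [zFrame, CField.part, zHor, prodThetaFrame, thetaFrame, lift, mkVec_smul, crFrame]
  · simp [zFrame, CField.part, zHor, prodThetaFrame, thetaFrame, lift, mkVec_smul, crFrame]
  · simp [zFrame, CField.part, CField.conj, zHor, prodThetaFrame, thetaFrame, lift, mkVec_smul,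
      crFrame]
  · simp [zFrame, CField.part, CField.conj, zHor, prodThetaFrame, thetaFrame, lift, mkVec_smul,
      crFrame]

lemma cExt₂_inner_eq {e : Unit ⊕ Unit ⊕ Fin (2 * n) → VField (prodModel n) (M × ℝ)}
    {g : ∀ x : M × ℝ, LinearMap.BilinForm ℝ (TangentSpace (prodModel n) x)}
    {A B : CField (prodModel n) (M × ℝ)} {a b : Bool → Unit ⊕ Unit ⊕ Fin (2 * n) → ℝ}
    (hA : ∀ i, A.part i = combo e fun _ => a i) (hB : ∀ i, B.part i = combo e fun _ => b i)
    (x : M × ℝ) :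
    cExt₂ (inner g) A B x = bil (fun I K => (gram g e x I K : ℂ)) (cvec a) (cvec b) := by
  rw [← sum_unitOf_bil]
  simp only [cExt₂, hA, hB, inner_combo]

section Vectors

/-- The complex coordinate vector of a member of the frame. -/
abbrev unitVec (I : Unit ⊕ Unit ⊕ Fin (2 * n)) : Unit ⊕ Unit ⊕ Fin (2 * n) → ℂ := Pi.single I 1

lemma ofReal_smul_single (r : ℝ) (I : Unit ⊕ Unit ⊕ Fin (2 * n)) :
    (fun K => (((r • Pi.single I 1 : Unit ⊕ Unit ⊕ Fin (2 * n) → ℝ) K : ℝ) : ℂ)) =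
      (r : ℂ) • unitVec I := by
  funext K
  by_cases h : K = I
  · subst h; simp
  · simp [h]

lemma cvec_inftyCoeff : cvec (inftyCoeff n) = unitVec (Sum.inl ()) := by
  simp only [cvec, inftyCoeff, ofReal_smul_single]
  simp

lemma cvec_zeroCoeff : cvec (zeroCoeff n) = unitVec (Sum.inr (Sum.inl ())) := by
  simp only [cvec, zeroCoeff, ofReal_smul_single]
  simp

lemma cvec_zCoeff_none (s : Bool) : cvec (zCoeff (n := n) (none, s)) =
    (1 / 2 : ℂ) • unitVec (Sum.inl ())
      + ((if s then -1 else 1 : ℂ) * Complex.I) • unitVec (Sum.inr (Sum.inl ())) := by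
  simp only [cvec, zCoeff, ofReal_smul_single]
  cases s <;> simp

lemma cvec_zCoeff_some (α : Fin n) (s : Bool) : cvec (zCoeff (some α, s)) =
    unitVec (Sum.inr (Sum.inr (partIndex n (α, false))))
      + ((if s then -1 else 1 : ℂ) * Complex.I) •
        unitVec (Sum.inr (Sum.inr (partIndex n (α, true)))) := by
  simp only [cvec, zCoeff, ofReal_smul_single]
  cases s <;> simp

lemma conj_cvec_zCoeff (A : Option (Fin n)) (s : Bool) :
    (fun I => starRingEnd ℂ (cvec (zCoeff (A, s)) I)) = cvec (zCoeff (A, !s)) := by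
  funext I
  rcases A with _ | α <;> cases s <;> simp [cvec, zCoeff, map_ofNat (starRingEnd ℂ) 2]

lemma conj_unitVec (J : Unit ⊕ Unit ⊕ Fin (2 * n)) :
    (fun I => starRingEnd ℂ (unitVec J I)) = unitVec J := by
  funext I
  by_cases h : I = J
  · subst h; simp
  · simp [h]

end Vectors

/-! ### The structure constants at the boundary -/

variable [IsManifold (𝓡 (2 * n + 1)) ∞ M]
  {S : PartiallyIntegrableCR n M} {θ : ∀ p : M, TangentSpace (𝓡 (2 * n + 1)) p →ₗ[ℝ] ℝ}
  {V : Set M}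

section Structure

variable {f : Unit ⊕ Fin (2 * n) → VField (𝓡 (2 * n + 1)) M}
  (hf : IsLocalFrameOn (𝓡 (2 * n + 1)) (Model n) ∞ f V)

/-- The structure constants of the `Θ`-frame at a boundary point, over `ℂ`. -/
def boundaryStructure (p : M) (I K L : Unit ⊕ Unit ⊕ Fin (2 * n)) : ℂ :=
  (thetaStructure hf (p, 0) I K L : ℂ)

lemma bracketCoeff_skew (I K L : Unit ⊕ Unit ⊕ Fin (2 * n)) (p : M) :
    bracketCoeff hf I K L p = -bracketCoeff hf K I L p := by
  rcases L with _ | L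
  · simp [bracketCoeff]
  · simp only [bracketCoeff, Sum.elim_inr]
    rw [← map_neg]
    congr 1
    exact VectorField.mlieBracket_swap_apply

lemma bracketCoeff_inl_left (u : Unit) (K L : Unit ⊕ Unit ⊕ Fin (2 * n)) (p : M) :
    bracketCoeff hf (Sum.inl u) K L p = 0 := by
  rcases L with _ | L
  · simp [bracketCoeff]
  · refine Eq.trans (congrArg (hf.coeff L p) ?_) (map_zero (hf.coeff L p))
    exact congrFun (VectorField.mlieBracket_zero_left (I := 𝓡 (2 * n + 1))
      (W := horField f K)) p

lemma boundaryStructure_skew (p : M) (u w : Unit ⊕ Unit ⊕ Fin (2 * n) → ℂ) :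
    tri (boundaryStructure hf p) u w = -tri (boundaryStructure hf p) w u := by
  have h : ∀ I K L, boundaryStructure hf p I K L = -boundaryStructure hf p K I L := by
    intro I K L
    simp only [boundaryStructure, thetaStructure]
    rw [bracketCoeff_skew, add_comm (weight n I)]
    push_cast
    ring
  funext L
  rw [Pi.neg_apply, tri_apply, tri_apply, Finset.sum_comm, ← Finset.sum_neg_distrib]
  refine Finset.sum_congr rfl fun K _ => ?_
  rw [← Finset.sum_neg_distrib]
  exact Finset.sum_congr rfl fun I _ => by rw [h]; ring

lemma br_infty_zero (p : M) : tri (boundaryStructure hf p) (unitVec (Sum.inl ()))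
    (unitVec (Sum.inr (Sum.inl ()))) = (2 : ℂ) • unitVec (Sum.inr (Sum.inl ())) := by
  rw [tri_single]
  funext L
  rcases L with _ | _ | i <;>
    simp [boundaryStructure, thetaStructure, weight, rhoCoeff, bracketCoeff_inl_left]
  norm_num

lemma br_infty_hor (p : M) (i : Fin (2 * n)) : tri (boundaryStructure hf p) (unitVec (Sum.inl ()))
    (unitVec (Sum.inr (Sum.inr i))) = unitVec (Sum.inr (Sum.inr i)) := by
  rw [tri_single]
  funext L
  rcases L with _ | _ | j
  · simp [boundaryStructure, thetaStructure, weight, rhoCoeff, bracketCoeff_inl_left]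
  · simp [boundaryStructure, thetaStructure, weight, bracketCoeff_inl_left]
  · by_cases h : i = j
    · subst h
      simp [boundaryStructure, thetaStructure, weight, rhoCoeff, bracketCoeff_inl_left]
    · simp [boundaryStructure, thetaStructure, weight, bracketCoeff_inl_left, h, Ne.symm h]

/-- `[ρ²T, ρY]` has the factor `ρ³`, so its coefficients in the `Θ`-frame vanish at `ρ = 0`. -/
lemma br_zero_hor (p : M) (i : Fin (2 * n)) :
    tri (boundaryStructure hf p) (unitVec (Sum.inr (Sum.inl ())))
      (unitVec (Sum.inr (Sum.inr i))) = 0 := by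
  rw [tri_single]
  funext L
  rcases L with _ | _ | j <;> simp [boundaryStructure, thetaStructure, weight, rhoCoeff]

lemma br_self (p : M) (u : Unit ⊕ Unit ⊕ Fin (2 * n) → ℂ) :
    tri (boundaryStructure hf p) u u = 0 := by
  have h := boundaryStructure_skew hf p u u
  have h2 : (2 : ℂ) • tri (boundaryStructure hf p) u u = 0 := by
    rw [two_smul]; nth_rewrite 1 [h]; simp
  simpa using h2

end Structure

/-- `[ρX, ρY] = ρ²[X, Y]`, of which only the `T`-component survives at `ρ = 0`. -/
lemma br_hor_hor (hθ : IsContactForm S θ) (hT : IsReebField θ T) (hZ : IsFrameOf S.T10 V Z)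
    {p : M} (hp : p ∈ V) (α β : Fin n) (a b : Bool) :
    tri (boundaryStructure (isLocalFrameOn_crFrame hθ hT hZ) p)
      (unitVec (Sum.inr (Sum.inr (partIndex n (α, a)))))
      (unitVec (Sum.inr (Sum.inr (partIndex n (β, b))))) =
      (thetaBracket θ Z p α a β b : ℂ) • unitVec (Sum.inr (Sum.inl ())) := by
  rw [tri_single]
  funext L
  rcases L with _ | _ | j
  · simp [boundaryStructure, thetaStructure, weight]
  · have h := coeff_crFrame_reeb hθ hT hZ hp
      (bracket _ ((Z α).part a) ((Z β).part b))
    have h1 : ∀ γ c, horField (crFrame T Z) (Sum.inr (Sum.inr (partIndex n (γ, c)))) =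
        (Z γ).part c := by
      intro γ c
      simp [horField, crFrame]
    simp [boundaryStructure, thetaStructure, weight, bracketCoeff, h1, thetaBracket, h]
  · simp [boundaryStructure, thetaStructure, weight, rhoCoeff]

end Boundary

/-! ### The boundary model of an ACH metric -/

section BoundaryModel

variable {n : ℕ} {M : Type*} [TopologicalSpace M] [ChartedSpace (Model n) M]
  [IsManifold (𝓡 (2 * n + 1)) ∞ M]
  {S : PartiallyIntegrableCR n M} {θ : ∀ p : M, TangentSpace (𝓡 (2 * n + 1)) p →ₗ[ℝ] ℝ}
  {T : VField (𝓡 (2 * n + 1)) M} {V : Set M} {Z : Fin n → CField (𝓡 (2 * n + 1)) M}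

/-- A vector that is orthogonal to the frame `Z_P` is orthogonal to everything. -/
lemma eq_zero_of_bil_cvec_zCoeff {G : Unit ⊕ Unit ⊕ Fin (2 * n) → Unit ⊕ Unit ⊕ Fin (2 * n) → ℂ}
    (hdet : (Matrix.of G).det ≠ 0) {u : Unit ⊕ Unit ⊕ Fin (2 * n) → ℂ}
    (h : ∀ P, bil G u (cvec (zCoeff P)) = 0) : u = 0 := by
  -- a vector orthogonal to `s X + i t Y` and to `s X - i t Y` is orthogonal to `X` and to `Y`
  have h1 : ∀ {x y s t : ℂ}, s * x + t * Complex.I * y = 0 → s * x - t * Complex.I * y = 0 →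
      s ≠ 0 → t ≠ 0 → x = 0 ∧ y = 0 := by
    intro x y s t h1 h2 hs ht
    refine ⟨(mul_eq_zero.1 (?_ : s * x = 0)).resolve_left hs,
      (mul_eq_zero.1 (?_ : t * Complex.I * y = 0)).resolve_left (mul_ne_zero ht Complex.I_ne_zero)⟩
    · linear_combination (h1 + h2) / 2
    · linear_combination (h1 - h2) / 2
  refine eq_zero_of_bil_eq_zero hdet fun I => ?_
  rcases I with _ | _ | i
  · have ha := h (none, false)
    have hb := h (none, true)
    rw [cvec_zCoeff_none] at ha hb
    simp only [map_add, map_smul, smul_eq_mul, if_true, Bool.false_eq_true, if_false] at ha hb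
    exact (h1 (s := 1 / 2) (t := 1) ha (by linear_combination hb) (by norm_num) one_ne_zero).1
  · have ha := h (none, false)
    have hb := h (none, true)
    rw [cvec_zCoeff_none] at ha hb
    simp only [map_add, map_smul, smul_eq_mul, if_true, Bool.false_eq_true, if_false] at ha hb
    exact (h1 (s := 1 / 2) (t := 1) ha (by linear_combination hb) (by norm_num) one_ne_zero).2
  · obtain ⟨⟨α, b⟩, rfl⟩ := (partIndex n).surjective i
    have ha := h (some α, false)
    have hb := h (some α, true)
    rw [cvec_zCoeff_some] at ha hb
    simp only [map_add, map_smul, smul_eq_mul, if_true, Bool.false_eq_true, if_false] at ha hb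
    have h2 := h1 (x := bil G u (unitVec (Sum.inr (Sum.inr (partIndex n (α, false))))))
      (y := bil G u (unitVec (Sum.inr (Sum.inr (partIndex n (α, true)))))) (s := 1) (t := 1)
      (by linear_combination ha) (by linear_combination hb) one_ne_zero one_ne_zero
    cases b
    · exact h2.1
    · exact h2.2

/-- At a boundary point, the frame `Z_P` spans the solvable Lie algebra of complex hyperbolic
space, and the metric is its hyperbolic metric. -/
lemma isHyperbolicModel_boundary (hθ : IsContactForm S θ) (hT : IsReebField θ T) (hV : IsOpen V)
    (hZ : IsFrameOf S.T10 V Z) {p : M} (hp : p ∈ V)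
    {G : Unit ⊕ Unit ⊕ Fin (2 * n) → Unit ⊕ Unit ⊕ Fin (2 * n) → ℝ}
    {Γ : Unit ⊕ Unit ⊕ Fin (2 * n) → Unit ⊕ Unit ⊕ Fin (2 * n) → Unit ⊕ Unit ⊕ Fin (2 * n) → ℂ}
    (hsymm : ∀ I K, G I K = G K I) (hdet : (Matrix.of G).det ≠ 0)
    (infty_infty : bil (fun I K => (G I K : ℂ)) (cvec (inftyCoeff n)) (cvec (inftyCoeff n)) = 4)
    (infty_zero : bil (fun I K => (G I K : ℂ)) (cvec (inftyCoeff n)) (cvec (zeroCoeff n)) = 0)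
    (zero_zero : bil (fun I K => (G I K : ℂ)) (cvec (zeroCoeff n)) (cvec (zeroCoeff n)) = 1)
    (infty_hor : ∀ α, bil (fun I K => (G I K : ℂ)) (cvec (inftyCoeff n))
      (cvec (zCoeff (some α, false))) = 0)
    (zero_hor : ∀ α, bil (fun I K => (G I K : ℂ)) (cvec (zeroCoeff n))
      (cvec (zCoeff (some α, false))) = 0)
    (hor_conj : ∀ α β, bil (fun I K => (G I K : ℂ)) (cvec (zCoeff (some α, false)))
      (cvec (zCoeff (some β, true))) = leviForm θ Z α β p)
    (hor_hor : ∀ α β, bil (fun I K => (G I K : ℂ)) (cvec (zCoeff (some α, false)))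
      (cvec (zCoeff (some β, false))) = 0)
    (hk : ∀ u w z, 2 * bil (fun I K => (G I K : ℂ)) (tri Γ u w) z =
      bil (fun I K => (G I K : ℂ))
        (tri (boundaryStructure (isLocalFrameOn_crFrame hθ hT hZ) p) u w) z
      - bil (fun I K => (G I K : ℂ))
        (tri (boundaryStructure (isLocalFrameOn_crFrame hθ hT hZ) p) u z) w
      - bil (fun I K => (G I K : ℂ))
        (tri (boundaryStructure (isLocalFrameOn_crFrame hθ hT hZ) p) w z) u) :
    IsHyperbolicModel (bil fun I K => (G I K : ℂ))
      (tri (boundaryStructure (isLocalFrameOn_crFrame hθ hT hZ) p)) (tri Γ)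
      (fun P => cvec (zCoeff P)) (fun α β => leviForm θ Z α β p) := by
  have hs : ∀ u w, bil (fun I K => (G I K : ℂ)) u w = bil (fun I K => (G I K : ℂ)) w u :=
    bil_symm fun I K => by rw [hsymm]
  rw [cvec_inftyCoeff] at infty_infty infty_zero
  rw [cvec_zeroCoeff] at zero_zero infty_zero
  have infty_part : ∀ α s, bil (fun I K => (G I K : ℂ)) (unitVec (Sum.inl ()))
      (cvec (zCoeff (some α, s))) = 0 := by
    intro α s
    have h := infty_hor α
    rw [cvec_inftyCoeff] at h
    cases s
    · exact h
    · rw [← conj_unitVec, show true = !false from rfl, ← conj_cvec_zCoeff, bil_conj, h, map_zero]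
  have zero_part : ∀ α s, bil (fun I K => (G I K : ℂ)) (unitVec (Sum.inr (Sum.inl ())))
      (cvec (zCoeff (some α, s))) = 0 := by
    intro α s
    have h := zero_hor α
    rw [cvec_zeroCoeff] at h
    cases s
    · exact h
    · rw [← conj_unitVec, show true = !false from rfl, ← conj_cvec_zCoeff, bil_conj, h, map_zero]
  have tau_hor : ∀ α s t, bil (fun I K => (G I K : ℂ)) (cvec (zCoeff (none, s)))
      (cvec (zCoeff (some α, t))) = 0 := by
    intro α s t
    rw [cvec_zCoeff_none, map_add, map_smul, map_smul, LinearMap.add_apply, LinearMap.smul_apply,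
      LinearMap.smul_apply, infty_part, zero_part]
    simp
  have tau_tau : ∀ s t, bil (fun I K => (G I K : ℂ)) (cvec (zCoeff (n := n) (none, s)))
      (cvec (zCoeff (none, t))) = if s = t then 0 else 2 := by
    intro s t
    rw [cvec_zCoeff_none, cvec_zCoeff_none]
    simp only [map_add, map_smul, LinearMap.add_apply, LinearMap.smul_apply, smul_eq_mul,
      infty_infty, zero_zero, infty_zero,
      hs (unitVec (Sum.inr (Sum.inl ()))) (unitVec (Sum.inl ()))]
    cases s <;> cases t <;> norm_num
  have hsame : ∀ α β s, bil (fun I K => (G I K : ℂ)) (cvec (zCoeff (some α, s)))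
      (cvec (zCoeff (some β, s))) = 0 := by
    intro α β s
    cases s
    · exact hor_hor α β
    · rw [show true = !false from rfl, ← conj_cvec_zCoeff, ← conj_cvec_zCoeff, bil_conj, hor_hor,
        map_zero]
  set hf := isLocalFrameOn_crFrame hθ hT hZ
  have hbr : ∀ (α β : Fin n) (s t : Bool), tri (boundaryStructure hf p) (cvec (zCoeff (some α, s)))
      (cvec (zCoeff (some β, t))) =
      (((thetaBracket θ Z p α false β false : ℂ)
        + (if s then -1 else 1) * Complex.I * thetaBracket θ Z p α true β false)
        + (if t then -1 else 1) * Complex.I * (thetaBracket θ Z p α false β true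
        + (if s then -1 else 1) * Complex.I * thetaBracket θ Z p α true β true)) •
        unitVec (Sum.inr (Sum.inl ())) := by
    intro α β s t
    rw [cvec_zCoeff_some, cvec_zCoeff_some]
    simp only [map_add, map_smul, LinearMap.add_apply, LinearMap.smul_apply,
      br_hor_hor hθ hT hZ hp, smul_smul, ← add_smul]
  have htau : cvec (zCoeff (n := n) (none, true)) - cvec (zCoeff (none, false)) =
      (-2 * Complex.I) • unitVec (Sum.inr (Sum.inl ())) := by
    rw [cvec_zCoeff_none, cvec_zCoeff_none, add_sub_add_left_eq_sub, ← sub_smul]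
    congr 1
    simp
    ring
  exact {
    symm := hs
    nondegenerate := fun u hu => eq_zero_of_bil_cvec_zCoeff (by
      have h := Complex.ofRealHom.map_det (Matrix.of G)
      intro h0
      refine hdet (Complex.ofReal_eq_zero.1 (h.trans ?_))
      rw [← h0]
      rfl) hu
    koszul := hk
    met_same := by
      rintro (_ | α) (_ | β) s
      · rw [tau_tau, if_pos rfl]
      · exact tau_hor _ _ _
      · rw [hs]; exact tau_hor _ _ _
      · exact hsame _ _ _
    met_tau_tau := by rw [tau_tau]; simp
    met_tau_hor := fun α s => tau_hor _ _ _
    met_hor_hor := hor_conj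
    skew := boundaryStructure_skew hf p
    br_tau_tau := by
      rw [htau, cvec_zCoeff_none, cvec_zCoeff_none]
      simp only [map_add, map_smul, LinearMap.add_apply, LinearMap.smul_apply, br_self,
        br_infty_zero, boundaryStructure_skew hf p (unitVec (Sum.inr (Sum.inl ())))
          (unitVec (Sum.inl ())), smul_smul, smul_zero, zero_add, add_zero,
        ← neg_smul, ← add_smul]
      congr 1
      simp
      ring
    br_tau_hor := by
      intro α s t
      rw [cvec_zCoeff_none, cvec_zCoeff_some]
      simp only [map_add, map_smul, LinearMap.add_apply, LinearMap.smul_apply, br_infty_hor,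
        br_zero_hor, smul_zero, add_zero, smul_add]
      rw [smul_comm]
    br_same := by
      intro α β s
      obtain ⟨h1, h2⟩ := thetaBracket_same hθ hV hZ hp α β
      rw [hbr, h1, h2, ← zero_smul ℂ (unitVec (Sum.inr (Sum.inl ())))]
      congr 1
      push_cast
      cases s <;> simp <;> linear_combination (thetaBracket θ Z p α true β true : ℂ) * Complex.I_sq
    br_hor_hor := by
      intro α β
      rw [htau, hbr, smul_smul]
      congr 1
      have h := thetaBracket_conj hθ hV hZ hp α β
      simp only [Bool.false_eq_true, if_false, if_true]
      linear_combination h - (thetaBracket θ Z p α true β true : ℂ) * Complex.I_sq }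

end BoundaryModel

/-! ### Extension of the metric to the boundary -/

section BoundaryValues

variable {n : ℕ} {M : Type*} [TopologicalSpace M] [ChartedSpace (Model n) M]

lemma uniqueMDiffOn_half {O : Set (M × ℝ)} (hO : IsOpen O) :
    UniqueMDiffOn (prodModel n) (half O) := by
  have h : half O = (Set.univ ×ˢ Set.Ici 0) ∩ O := by
    ext x; simp [half, and_comm]
  rw [h]
  exact (uniqueMDiffOn_univ.prod (uniqueDiffOn_Ici 0).uniqueMDiffOn).inter hO

/-- Boundary points are limits of interior points, so boundary values are unique. -/
lemma mem_closure_interior (p : M) : (p, (0 : ℝ)) ∈ closure {x : M × ℝ | 0 < x.2} := by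
  have h : {x : M × ℝ | 0 < x.2} = Set.univ ×ˢ Set.Ioi (0 : ℝ) := by ext; simp
  rw [h, closure_prod_eq, closure_Ioi]
  simp

/-- A continuous extension of `f` takes the boundary values of `f`. -/
lemma HasBoundaryValue.eq_of_continuousWithinAt {f F : M × ℝ → ℂ} {p : M} {c : ℂ}
    (h : HasBoundaryValue f p c) {O : Set (M × ℝ)} (hO : IsOpen O) (hp : (p, (0 : ℝ)) ∈ O)
    (hF : ContinuousWithinAt F (half O) (p, 0)) (hFf : ∀ x ∈ O, 0 < x.2 → F x = f x) :
    F (p, 0) = c := by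
  have : (𝓝[{x : M × ℝ | 0 < x.2}] (p, 0)).NeBot :=
    mem_closure_iff_nhdsWithin_neBot.1 (mem_closure_interior p)
  have hle : 𝓝[{x : M × ℝ | 0 < x.2}] (p, 0) ≤ 𝓝[half O] (p, 0) := by
    rw [nhdsWithin_le_iff]
    filter_upwards [self_mem_nhdsWithin, mem_nhdsWithin_of_mem_nhds (hO.mem_nhds hp)] with x h1 h2
    exact ⟨h2, le_of_lt h1⟩
  refine tendsto_nhds_unique (hF.mono_left hle) (Filter.Tendsto.congr' ?_ h)
  filter_upwards [self_mem_nhdsWithin, mem_nhdsWithin_of_mem_nhds (hO.mem_nhds hp)] with x h1 h2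
  exact (hFf x h2 h1).symm

lemma IsSmoothExtension.const_mul {O : Set (M × ℝ)} {f F : M × ℝ → ℂ}
    (h : IsSmoothExtension (n := n) O f F) (c : ℂ) :
    IsSmoothExtension (n := n) O (fun x => c * f x) (fun x => c * F x) :=
  ⟨ContMDiffOn.comp (t := Set.univ) (g := fun z : ℂ => c * z)
    ((contDiff_const.mul contDiff_id).contMDiff.contMDiffOn)
    h.1 (fun _ _ => Set.mem_univ _), fun x hx h0 => congrArg (c * ·) (h.2 x hx h0)⟩

lemma IsSmoothExtension.ofReal {O : Set (M × ℝ)} {f F : M × ℝ → ℝ}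
    (h : IsSmoothExtension (n := n) O f F) :
    IsSmoothExtension (n := n) O (fun x => (f x : ℂ)) (fun x => (F x : ℂ)) :=
  ⟨ContMDiff.comp_contMDiffOn (g := fun r : ℝ => (r : ℂ)) Complex.ofRealCLM.contDiff.contMDiff h.1,
    fun x hx h0 => congrArg _ (h.2 x hx h0)⟩

lemma IsSmoothExtension.sum {κ : Type*} {s : Finset κ} {O : Set (M × ℝ)} {f F : κ → M × ℝ → ℂ}
    (h : ∀ i ∈ s, IsSmoothExtension (n := n) O (f i) (F i)) :
    IsSmoothExtension (n := n) O (fun x => ∑ i ∈ s, f i x) (fun x => ∑ i ∈ s, F i x) :=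
  ⟨fun x hx => contMDiffWithinAt_finsetSum fun i hi => (h i hi).1 x hx,
    fun x hx h0 => Finset.sum_congr rfl fun i hi => (h i hi).2 x hx h0⟩

section

variable {g : ∀ x : M × ℝ, LinearMap.BilinForm ℝ (TangentSpace (prodModel n) x)}
  {e : Unit ⊕ Unit ⊕ Fin (2 * n) → VField (prodModel n) (M × ℝ)} {O : Set (M × ℝ)}
  {G : M × ℝ → Unit ⊕ Unit ⊕ Fin (2 * n) → Unit ⊕ Unit ⊕ Fin (2 * n) → ℝ}

lemma isSmoothExtension_cExt₂
    (hG : ∀ I K, ContMDiffOn (prodModel n) 𝓘(ℝ, ℝ) ∞ (fun x => G x I K) (half O))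
    (hgram : ∀ x ∈ O, 0 < x.2 → gram g e x = G x)
    {A B : CField (prodModel n) (M × ℝ)} {a b : Bool → Unit ⊕ Unit ⊕ Fin (2 * n) → ℝ}
    (hA : ∀ i, A.part i = combo e fun _ => a i) (hB : ∀ i, B.part i = combo e fun _ => b i) :
    IsSmoothExtension (n := n) O (cExt₂ (inner g) A B)
      (fun x => bil (fun I K => (G x I K : ℂ)) (cvec a) (cvec b)) := by
  refine ⟨?_, fun x hx h0 => by rw [cExt₂_inner_eq hA hB, hgram x hx h0]⟩
  simp only [← sum_unitOf_bil]
  have h : ∀ i j, IsSmoothExtension (n := n) O (fun x => bil (G x) (a i) (b j))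
      (fun x => bil (G x) (a i) (b j)) := fun i j =>
    ⟨contMDiffOn_bil hG (fun _ => contMDiffOn_const) (fun _ => contMDiffOn_const),
      fun _ _ _ => rfl⟩
  exact (IsSmoothExtension.sum fun i _ => IsSmoothExtension.sum fun j _ =>
    (h i j).ofReal.const_mul (unitOf i * unitOf j)).1

/-- The boundary values of the metric, in terms of the extension `G` of its matrix. -/
lemma HasBoundaryValue.bil_eq
    (hG : ∀ I K, ContMDiffOn (prodModel n) 𝓘(ℝ, ℝ) ∞ (fun x => G x I K) (half O))
    (hgram : ∀ x ∈ O, 0 < x.2 → gram g e x = G x) (hO : IsOpen O)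
    {p : M} (hp : (p, (0 : ℝ)) ∈ O)
    {A B : CField (prodModel n) (M × ℝ)} {a b : Bool → Unit ⊕ Unit ⊕ Fin (2 * n) → ℝ}
    {c : ℂ} (h : HasBoundaryValue (cExt₂ (inner g) A B) p c)
    (hA : ∀ i, A.part i = combo e fun _ => a i) (hB : ∀ i, B.part i = combo e fun _ => b i) :
    bil (fun I K => (G (p, 0) I K : ℂ)) (cvec a) (cvec b) = c := by
  have h1 := isSmoothExtension_cExt₂ hG hgram hA hB
  exact h.eq_of_continuousWithinAt hO hp (h1.1.continuousOn _ ⟨hp, le_rfl⟩) h1.2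

end

variable [IsManifold (𝓡 (2 * n + 1)) ∞ M]
  {S : PartiallyIntegrableCR n M} {θ : ∀ p : M, TangentSpace (𝓡 (2 * n + 1)) p →ₗ[ℝ] ℝ}
  {T : VField (𝓡 (2 * n + 1)) M} {V : Set M} {Z : Fin n → CField (𝓡 (2 * n + 1)) M}

lemma smoothFieldAt_prodThetaFrame {f : Unit ⊕ Fin (2 * n) → VField (𝓡 (2 * n + 1)) M}
    (hf : IsLocalFrameOn (𝓡 (2 * n + 1)) (Model n) ∞ f V) (hV : IsOpen V) {x : M × ℝ}
    (hx : x.1 ∈ V) (I : Unit ⊕ Unit ⊕ Fin (2 * n)) :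
    SmoothFieldAt (prodModel n) (prodThetaFrame f I) x := by
  rw [prodThetaFrame_eq]
  exact ContMDiffAt.smul_section (contMDiff_rho_pow _).contMDiffAt (smoothFieldAt_lift _
      (smoothFieldAt_horField hf hV hx I))

lemma isAdaptedFrame_crFrame (hθ : IsContactForm S θ) (hT : IsReebField θ T) (hV : IsOpen V)
    (hZ : IsFrameOf S.T10 V Z) {O : Set (M × ℝ)} (hO : ∀ x ∈ O, x.1 ∈ V) :
    IsAdaptedFrame θ O (lift 0 1) (lift (crFrame T Z (Sum.inl ())) 0)
      (fun i => lift (crFrame T Z (Sum.inr i)) 0) where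
  smooth_N x hx := (smoothFieldAt_lift 1 (smoothFieldAt_horField
    (isLocalFrameOn_crFrame hθ hT hZ) hV (hO x hx.1) (Sum.inl ()))).contMDiffWithinAt
  smooth_T x hx := (smoothFieldAt_lift 0 (smoothFieldAt_horField
    (isLocalFrameOn_crFrame hθ hT hZ) hV (hO x hx.1) (Sum.inr (Sum.inl ())))).contMDiffWithinAt
  smooth_Y i x hx := (smoothFieldAt_lift 0 (smoothFieldAt_horField
    (isLocalFrameOn_crFrame hθ hT hZ) hV (hO x hx.1) (Sum.inr (Sum.inr i)))).contMDiffWithinAt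
  linearIndependent x hx := by
    have h := linearIndependent_smul_lift (x := x)
      ((isLocalFrameOn_crFrame hθ hT hZ).linearIndependent (hO x hx.1)) (r := fun _ => 1)
      fun _ => one_ne_zero
    convert h using 1
    funext I
    rcases I with _ | _ | i <;> simp [horField, rhoCoeff]
  theta_N x _ _ := map_zero (θ x.1)
  tangent_T _ _ _ := rfl
  tangent_Y _ _ _ _ := rfl
  theta_Y x hx _ i := hθ.apply_part hZ (hO x hx) _ _

end BoundaryValues

section MetricExtension

variable {n : ℕ} {M : Type*} [TopologicalSpace M] [ChartedSpace (Model n) M]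
  [IsManifold (𝓡 (2 * n + 1)) ∞ M]
  {S : PartiallyIntegrableCR n M} {θ : ∀ p : M, TangentSpace (𝓡 (2 * n + 1)) p →ₗ[ℝ] ℝ}
  {T : VField (𝓡 (2 * n + 1)) M} {V : Set M} {Z : Fin n → CField (𝓡 (2 * n + 1)) M}
  {g : ∀ x : M × ℝ, LinearMap.BilinForm ℝ (TangentSpace (prodModel n) x)}

/-- The matrix of a `Θ`-metric in the frame `ρ∂_ρ, ρ²T, ρ Re Z_α, ρ Im Z_α` extends to the boundary
as a smooth, symmetric and invertible matrix. -/
lemma IsThetaMetric.exists_gram (hθ : IsContactForm S θ) (hT : IsReebField θ T)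
    {U : Set (M × ℝ)} (hg : IsThetaMetric θ U g) (hV : IsOpen V) (hZ : IsFrameOf S.T10 V Z)
    {O : Set (M × ℝ)} (hO : IsOpen O) (hOU : O ⊆ U) (hOV : ∀ x ∈ O, x.1 ∈ V) :
    ∃ G : M × ℝ → Unit ⊕ Unit ⊕ Fin (2 * n) → Unit ⊕ Unit ⊕ Fin (2 * n) → ℝ,
      (∀ I K, ContMDiffOn (prodModel n) 𝓘(ℝ, ℝ) ∞ (fun x => G x I K) (half O)) ∧
      (∀ x ∈ O, 0 < x.2 → gram g (prodThetaFrame (crFrame T Z)) x = G x) ∧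
      (∀ x ∈ half O, (Matrix.of (G x)).det ≠ 0) ∧
      ∀ p : M, (p, 0) ∈ O → ∀ I K, G (p, 0) I K = G (p, 0) K I := by
  obtain ⟨G, hG, hdet⟩ := hg.smooth_nondegenerate O _ _ _ hO hOU
    (isAdaptedFrame_crFrame hθ hT hV hZ hOV)
  refine ⟨fun x I K => G I K x, fun I K => (hG I K).1, fun x hx h0 => ?_, fun x hx => ?_,
    fun p hp I K => ?_⟩
  · funext I K
    exact ((hG I K).2 x hx h0).symm
  · convert hdet x hx
  · have h := fun I K => (hG I K).ofReal
    -- symmetry in the interior persists in the limit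
    have hc : HasBoundaryValue (fun x => (G I K x : ℂ) - (G K I x : ℂ)) p 0 := by
      refine Filter.Tendsto.congr' ?_ tendsto_const_nhds
      filter_upwards [self_mem_nhdsWithin, mem_nhdsWithin_of_mem_nhds (hO.mem_nhds hp)] with x h1 h2
      rw [(hG I K).2 x h2 h1, (hG K I).2 x h2 h1, inner, inner, hg.symm x (hOU h2) h1, sub_self]
    have h0 := hc.eq_of_continuousWithinAt hO hp
      (((h I K).1.continuousOn _ ⟨hp, le_rfl⟩).sub ((h K I).1.continuousOn _ ⟨hp, le_rfl⟩))
      fun _ _ _ => rfl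
    exact Complex.ofReal_injective (sub_eq_zero.1 h0)

end MetricExtension

end ACH

end

theorem mainTheorem9 {n : ℕ} {M : Type*} [TopologicalSpace M] [ChartedSpace (ACH.Model n) M]
    [IsManifold (𝓡 (2 * n + 1)) ∞ M]
    (S : ACH.PartiallyIntegrableCR n M)
    (θ : ∀ p : M, TangentSpace (𝓡 (2 * n + 1)) p →ₗ[ℝ] ℝ) (hθ : ACH.IsContactForm S θ)
    (T : ACH.VField (𝓡 (2 * n + 1)) M) (hT : ACH.IsReebField θ T)
    (U : Set (M × ℝ))
    (g : ∀ x : M × ℝ, LinearMap.BilinForm ℝ (TangentSpace (ACH.prodModel n) x))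
    (hg : ACH.IsNormalizedACHMetric S θ T U g)
    (V : Set M) (hV : IsOpen V) (Z : Fin n → ACH.CField (𝓡 (2 * n + 1)) M)
    (hZ : ACH.IsFrameOf S.T10 V Z) :
    ∃ (G : Option (Fin n) × Bool → Option (Fin n) × Bool → M × ℝ → ℂ)
      (R : Option (Fin n) × Bool → Option (Fin n) × Bool → Option (Fin n) × Bool →
        Option (Fin n) × Bool → M × ℝ → ℂ),
      -- `G P Q` and `R P Q P' Q'` are the components of the metric and of its curvature tensor as
      -- `Θ`-tensors, smooth up to the boundary
      (∀ P Q, ACH.IsSmoothExtension (n := n) (U ∩ {x | x.1 ∈ V})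
        (ACH.cExt₂ (ACH.inner g) (ACH.zFrame T Z P) (ACH.zFrame T Z Q)) (G P Q)) ∧
      (∀ P Q P' Q', ACH.IsSmoothExtension (n := n) (U ∩ {x | x.1 ∈ V})
        (ACH.cExt₄ (ACH.riemann g) (ACH.zFrame T Z P) (ACH.zFrame T Z Q)
          (ACH.zFrame T Z P') (ACH.zFrame T Z Q')) (R P Q P' Q')) ∧
      -- components that are not of Kähler type vanish on the boundary
      (∀ p ∈ V, ∀ P Q P' Q', (P.2 = Q.2 ∨ P'.2 = Q'.2) → R P Q P' Q' (p, 0) = 0) ∧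
      -- boundary values of the components of Kähler type
      (∀ p ∈ V, ∀ A B C D : Option (Fin n),
        R (A, false) (B, true) (C, false) (D, true) (p, 0) =
          -(1 / 2) * (G (A, false) (B, true) (p, 0) * G (C, false) (D, true) (p, 0) +
            G (A, false) (D, true) (p, 0) * G (C, false) (B, true) (p, 0))) := by
  classical
  set O : Set (M × ℝ) := U ∩ {x | x.1 ∈ V}
  have hO : IsOpen O := hg.isOpen.inter (hV.preimage continuous_fst)
  have hOV : ∀ x ∈ O, x.1 ∈ V := fun x hx => hx.2
  have hpO : ∀ p ∈ V, (p, (0 : ℝ)) ∈ O := fun p hp => ⟨hg.boundary_mem p, hp⟩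
  obtain ⟨G, hG, hgram, hdet, hsymm⟩ :=
    hg.thetaMetric.exists_gram hθ hT hV hZ hO Set.inter_subset_left hOV
  set hf := ACH.isLocalFrameOn_crFrame hθ hT hZ
  set e := ACH.prodThetaFrame (ACH.crFrame T Z)
  set c : M × ℝ → _ → _ → _ → ℝ := fun x I K L => ACH.thetaStructure hf x I K L
  have hS := ACH.uniqueMDiffOn_half (n := n) hO
  set Ω : Set (M × ℝ) := O ∩ {x | 0 < x.2}
  have hΩ : IsOpen Ω := hO.inter (isOpen_lt continuous_const continuous_snd)
  have hΩS : Ω ⊆ ACH.half O := fun x hx => ⟨hx.1, le_of_lt hx.2⟩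
  have he : ∀ I, ∀ x ∈ ACH.half O, ACH.SmoothFieldAt (ACH.prodModel n) (e I) x := fun I x hx =>
    ACH.smoothFieldAt_prodThetaFrame hf hV (hOV x hx.1) I
  have hc : ∀ I K L, ContMDiffOn (ACH.prodModel n) 𝓘(ℝ, ℝ) ∞ (fun y => c y I K L) (ACH.half O) :=
    fun I K L x hx =>
      (ACH.contMDiffAt_thetaStructure hf hV (hOV x hx.1) I K L).contMDiffWithinAt
  have hgram' : ∀ x ∈ Ω, ACH.gram g e x = G x := fun x hx => hgram x hx.1 hx.2
  have hframe := ACH.isMetricFrame_christoffel (g := g) (c := c) hΩ hΩS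
    (ACH.isLocalFrameOn_prodThetaFrame hf hV fun x hx => ⟨hOV x hx.1, hx.2⟩)
    (fun x hx I K => ACH.bracket_prodThetaFrame hf hV (hOV x hx.1) I K)
    (fun x hx => hg.thetaMetric.symm x hx.1.1 hx.2) hG hdet hgram'
  have hR : ∀ a b u w, ∀ x ∈ O, 0 < x.2 → ACH.curvArray (ACH.half O) e G c a b u w x =
      ACH.riemann g (ACH.combo e fun _ => a) (ACH.combo e fun _ => b) (ACH.combo e fun _ => u)
        (ACH.combo e fun _ => w) x := fun a b u w x hx h0 =>
    (ACH.riemann_eq_curvArray hframe hΩS hS he hG hdet hc hgram' ⟨hx, h0⟩ a b u w).symm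
  have hmodel : ∀ p ∈ V, ACH.IsHyperbolicModel (ACH.bil fun I K => (G (p, 0) I K : ℂ))
      (ACH.tri (ACH.boundaryStructure hf p))
      (ACH.tri fun I K L => (ACH.christoffel (ACH.half O) e G c (p, 0) I K L : ℂ))
      (fun P => ACH.cvec (ACH.zCoeff P)) (fun α β => ACH.leviForm θ Z α β p) := by
    intro p hp
    have hb := fun {A B} {a b} {z} => ACH.HasBoundaryValue.bil_eq (A := A) (B := B) (a := a)
      (b := b) (c := z) hG hgram hO (hpO p hp)
    exact ACH.isHyperbolicModel_boundary hθ hT hV hZ hp (hsymm p (hpO p hp))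
      (hdet _ ⟨hpO p hp, le_rfl⟩)
      (hb (hg.infty_infty p) ACH.part_zInfty ACH.part_zInfty)
      (hb (hg.infty_zero p) ACH.part_zInfty ACH.part_zZero)
      (hb (hg.zero_zero p) ACH.part_zZero ACH.part_zZero)
      (fun α => hb (hg.infty_hor V Z hV hZ p hp α) ACH.part_zInfty
        (ACH.part_zFrame (some α, false)))
      (fun α => hb (hg.zero_hor V Z hV hZ p hp α) ACH.part_zZero (ACH.part_zFrame (some α, false)))
      (fun α β => hb (hg.hor_conj V Z hV hZ p hp α β) (ACH.part_zFrame (some α, false))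
        (ACH.part_zFrame (some β, true)))
      (fun α β => hb (hg.hor_hor V Z hV hZ p hp α β) (ACH.part_zFrame (some α, false))
        (ACH.part_zFrame (some β, false)))
      (ACH.koszul_christoffel (ACH.prodThetaFrame_boundary _ · p) (hdet _ ⟨hpO p hp, le_rfl⟩))
  -- the boundary values of the curvature tensor are the curvature of the model
  have hcurv : ∀ p ∈ V, ∀ P Q P' Q', ∑ i : Bool, ∑ j : Bool, ∑ k : Bool, ∑ l : Bool,
      ACH.unitOf i * ACH.unitOf j * ACH.unitOf k * ACH.unitOf l *
        (ACH.curvArray (ACH.half O) e G c (ACH.zCoeff P i) (ACH.zCoeff Q j) (ACH.zCoeff P' k)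
          (ACH.zCoeff Q' l) (p, 0) : ℂ) = _ := fun p hp P Q P' Q' => by
    simp only [ACH.curvArray_eq_algCurv (S := ACH.half O) (e := e) (G := G) (c := c) (x := (p, 0))
      fun I => ACH.prodThetaFrame_boundary _ I p]
    exact ACH.sum_unitOf_algCurv _ _ _ _ _ _ _
  refine ⟨fun P Q x => ACH.bil (fun I K => (G x I K : ℂ)) (ACH.cvec (ACH.zCoeff P))
      (ACH.cvec (ACH.zCoeff Q)),
    fun P Q P' Q' x => ∑ i : Bool, ∑ j : Bool, ∑ k : Bool, ∑ l : Bool,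
      ACH.unitOf i * ACH.unitOf j * ACH.unitOf k * ACH.unitOf l *
        (ACH.curvArray (ACH.half O) e G c (ACH.zCoeff P i) (ACH.zCoeff Q j) (ACH.zCoeff P' k)
          (ACH.zCoeff Q' l) x : ℂ), fun P Q => ?_, fun P Q P' Q' => ?_, ?_, ?_⟩
  · exact ACH.isSmoothExtension_cExt₂ hG hgram (ACH.part_zFrame P) (ACH.part_zFrame Q)
  · unfold ACH.cExt₄
    refine ACH.IsSmoothExtension.sum fun i _ => ACH.IsSmoothExtension.sum fun j _ =>
      ACH.IsSmoothExtension.sum fun k _ => ACH.IsSmoothExtension.sum fun l _ =>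
      ACH.IsSmoothExtension.const_mul (ACH.IsSmoothExtension.ofReal
        ⟨ACH.contMDiffOn_curvArray hS he hG hdet hc _ _ _ _, fun x hx h0 => ?_⟩) _
    rw [ACH.part_zFrame, ACH.part_zFrame, ACH.part_zFrame, ACH.part_zFrame]
    exact hR _ _ _ _ x hx h0
  · intro p hp P Q P' Q' h
    exact (hcurv p hp P Q P' Q').trans (((hmodel p hp).curvature_eq P Q P' Q').trans (if_pos h))
  · intro p hp A B C D
    refine (hcurv p hp _ _ _ _).trans (((hmodel p hp).curvature_eq _ _ _ _).trans ?_)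
    simp
    ring
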